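/- Let $0<q<1$ and let $m$ be a nonnegative integer. Put $\square(q)=\sum_{n=-\infty}^{\infty}q^{n^2}$, and define the (normalized tangent) numbers $t_k$, $k\ge 1$, by the Taylor expansion at $0$ $$\tan\frac x2=\sum_{k=1}^\infty t_k\,\frac{x^{2k-1}}{(2k-1)!}.$$ Then $$\square(q)^{4m^2}=\frac{2^{m(2m-1)}}{\prod_{i=1}^{2m-1}i!}\,\det_{1\le i,j\le m}\left(t_{i+j-1}+4(-1)^{i+j}\sum_{k=1}^\infty\frac{q^k k^{2i+2j-3}}{1+(-q)^k}\right)$$ and $$\square(q)^{4m(m+1)}=\frac{2^{m(2m+1)}}{\prod_{i=1}^{2m}i!}\,\det_{1\le i,j\le m}\left(t_{i+j}+4(-1)^{i+j}\sum_{k=1}^\infty\frac{q^k k^{2i+2j-1}}{1-(-q)^k}\right),$$ where empty products and determinants of size $0$ are equal to $1$. -/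

import Mathlib

open scoped BigOperators Nat Topology

/-- The generating function of the squares, `□(q) = ∑_{n ∈ ℤ} q^(n^2)`. -/
noncomputable def squareSeries (q : ℝ) : ℝ := ∑' n : ℤ, q ^ (n ^ 2)

/-- The normalized tangent numbers `t_k` (`k ≥ 1`): the coefficients in
`tan (x / 2) = ∑_{k ≥ 1} t_k x^(2k-1) / (2k-1)!`. Thus `t_k` is the derivative of order `2k - 1`
of `tan (x / 2)` at `0`. The expansion is proved in `tan_half_hasSum`. The value at `k = 0` has
no meaning and is not used. -/
noncomputable def tangentNumber (k : ℕ) : ℝ :=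
  iteratedDeriv (2 * k - 1) (fun x : ℝ => Real.tan (x / 2)) 0

/-- The expansion that defines the numbers `t_k` (with `k` shifted by one). -/
theorem tan_half_hasSum :
    ∀ᶠ x : ℝ in 𝓝 0, HasSum
      (fun k : ℕ => tangentNumber (k + 1) * x ^ (2 * k + 1) / ((2 * k + 1)! : ℝ))
      (Real.tan (x / 2)) := by
  have hA : AnalyticAt ℝ (fun x : ℝ => Real.tan (x / 2)) 0 := by
    have h : (fun x : ℝ => Real.tan (x / 2)) =
        fun x : ℝ => Real.sin (x / 2) / Real.cos (x / 2) := by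
      funext x
      exact Real.tan_eq_sin_div_cos _
    have hd : AnalyticAt ℝ (fun x : ℝ => x / 2) 0 := analyticAt_id.div_const
    rw [h]
    refine AnalyticAt.div (Real.analyticAt_sin.fun_comp hd) (Real.analyticAt_cos.fun_comp hd) ?_
    simp
  have heven : ∀ k : ℕ, iteratedDeriv (2 * k) (fun x : ℝ => Real.tan (x / 2)) 0 = 0 := by
    intro k
    have h1 := iteratedDeriv_comp_neg (2 * k) (fun x : ℝ => Real.tan (x / 2)) 0
    have h2 : (fun x : ℝ => Real.tan (-x / 2)) = fun x : ℝ => -Real.tan (x / 2) := by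
      funext x
      rw [neg_div, Real.tan_neg]
    rw [h2, iteratedDeriv_fun_neg] at h1
    simp at h1
    linarith
  have hev := hA.hasFPowerSeriesAt.eventually_hasSum
  filter_upwards [hev] with x hx
  rw [zero_add] at hx
  simp only [FormalMultilinearSeries.ofScalars_apply_eq, smul_eq_mul] at hx
  have hinj : Function.Injective (fun k : ℕ => 2 * k + 1) := fun a b h => by
    simp only at h
    omega
  have h := (hinj.hasSum_iff (fun n hn => ?_)).2 hx
  · have e : (fun k : ℕ => tangentNumber (k + 1) * x ^ (2 * k + 1) / ((2 * k + 1)! : ℝ)) =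
        (fun n : ℕ => iteratedDeriv n (fun x : ℝ => Real.tan (x / 2)) 0 / (n ! : ℝ) * x ^ n) ∘
          fun k : ℕ => 2 * k + 1 := by
      funext k
      simp only [Function.comp, tangentNumber]
      have : 2 * (k + 1) - 1 = 2 * k + 1 := by omega
      rw [this]
      ring
    rw [e]
    exact h
  · obtain ⟨k, rfl | rfl⟩ := n.even_or_odd'
    · simp [heven]
    · exact absurd ⟨k, rfl⟩ hn

/-- The series `□(q)` converges for `0 < q < 1`. -/
theorem squareSeries_summable {q : ℝ} (h0 : 0 < q) (h1 : q < 1) :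
    Summable (fun n : ℤ => q ^ (n ^ 2)) := by
  have hn : Summable (fun n : ℕ => q ^ (n ^ 2)) := by
    refine Summable.of_nonneg_of_le (fun n => by positivity) (fun n => ?_)
      (summable_geometric_of_lt_one h0.le h1)
    exact pow_le_pow_of_le_one h0.le h1.le (by nlinarith [sq_nonneg (n : ℤ), Nat.le_self_pow two_ne_zero n])
  refine Summable.of_nat_of_neg ?_ ?_
  · exact_mod_cast hn
  · simp only [neg_sq]
    exact_mod_cast hn

/-- The Lambert series in the two formulas converge for `0 < q < 1`. -/
theorem lambert_summable {q : ℝ} (h0 : 0 < q) (h1 : q < 1) (r : ℕ) :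
    Summable (fun k : ℕ+ => q ^ (k : ℕ) * (k : ℝ) ^ r / (1 + (-q) ^ (k : ℕ))) ∧
    Summable (fun k : ℕ+ => q ^ (k : ℕ) * (k : ℝ) ^ r / (1 - (-q) ^ (k : ℕ))) := by
  have hs : Summable (fun k : ℕ+ => (k : ℝ) ^ r * q ^ (k : ℕ) / (1 - q)) := by
    have h := (summable_pow_mul_geometric_of_norm_lt_one r
      (show ‖q‖ < 1 by rwa [Real.norm_of_nonneg h0.le])).div_const (1 - q)
    exact h.comp_injective PNat.coe_injective
  have hp : ∀ k : ℕ+, |(-q) ^ (k : ℕ)| ≤ q := by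
    intro k
    rw [abs_pow, abs_neg, abs_of_pos h0]
    exact pow_le_of_le_one h0.le h1.le k.ne_zero
  have key : ∀ (k : ℕ+) (d : ℝ), 1 - q ≤ d →
      ‖q ^ (k : ℕ) * (k : ℝ) ^ r / d‖ ≤ (k : ℝ) ^ r * q ^ (k : ℕ) / (1 - q) := by
    intro k d hd
    have hq : 0 < 1 - q := by linarith
    rw [Real.norm_of_nonneg (div_nonneg (by positivity) (by linarith)), mul_comm]
    gcongr
  refine ⟨Summable.of_norm_bounded hs fun k => key k _ ?_,
    Summable.of_norm_bounded hs fun k => key k _ ?_⟩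
  · have := (abs_le.1 (hp k)).1
    linarith
  · have := (abs_le.1 (hp k)).2
    linarith

open Filter

/-! Both determinants are Hankel determinants of Taylor data of the functions f = `plusTan q` and g
= `minusTan q`. The proof rests on three facts: f'' = T f + f³/2, f² = κ + 2 g', and f'(0) =
□(q)⁴/2. The constants κ and T are never evaluated, since the determinants do not depend on them.

Algebra (`exists_iterate_derivative_eq`, `det_hankel_pow`). Let Y be a power series with Y(0) = 0
and Y'' = αY + 2βY³. Then Y'² is a polynomial in Y², so for e = 1, 2 the derivative of order 2i of
Y^e is a constant plus a combination of Y^e, Y^(e+2), ..., Y^(e+2i), with top coefficient (2i+e-1)!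
β^i. Since Y^(e+2r) vanishes to order e+2r at 0, the Hankel matrix of the derivatives of Y^e at 0 is
a lower triangular matrix times an upper triangular one, and its determinant is the product of the
diagonals. It involves only β and Y'(0). With Y the Taylor series of f and β = 1/4, e = 1 gives the
first formula; e = 2 gives the second, because g' = (f² - κ)/2.

Differential equations (`exists_boundary_identities`, `exists_trig_identities`). Put K(z) = ∑
zⁿ/(1+pⁿ) and L(z) = ∑ n zⁿ/(1-pⁿ) over all integers n, in the annulus |p| < |z| < 1. Partial
fractions turn the convolutions of the coefficients into telescoping sums, which gives K² = κ + L
and K L = T K + (1/2)(z d/dz)² K, with other constants κ, T. After passage to |z| = 1, the choice p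
= -q, z = -exp(ix) makes K, L and (z d/dz)² K multiples of f, g' and f''.

Initial slope (`squareSeries_sq`, `squareSeries_pow_four`). That f'(0) = □(q)⁴/2 is Jacobi's four
square theorem. It follows from the same identity for K², now at p = q², z = q, where K = □(q)²/2 by
the two square theorem. The latter is proved by showing that the quotient of its two sides is
invariant under q ↦ q² and letting q tend to 0. -/

theorem HasSum.of_eq {ι α : Type*} [AddCommMonoid α] [TopologicalSpace α] {f g : ι → α} {a b : α}
    (h : HasSum f a) (hf : ∀ i, g i = f i) (hb : b = a) : HasSum g b := by
  rwa [hb, funext hf]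

/-! ### Bilateral Lambert series and their products -/

section Bilateral

variable {𝕜 : Type*} [RCLike 𝕜]

/-- The coefficients `1 / (1 + p ^ n)`. -/
noncomputable def plusCoeff (p : 𝕜) (n : ℤ) : 𝕜 := (1 + p ^ n)⁻¹

/-- The coefficients `1 / (1 - p ^ n)`, with value `0` at `n = 0`. -/
noncomputable def minusCoeff (p : 𝕜) (n : ℤ) : 𝕜 := (1 - p ^ n)⁻¹

theorem zpow_ne_of_norm_eq_one {p c : 𝕜} (hp0 : p ≠ 0) (hp1 : ‖p‖ < 1) (hc : ‖c‖ = 1)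
    {n : ℤ} (hn : n ≠ 0) : p ^ n ≠ c := by
  intro h
  have h2 : ‖p‖ ^ n = 1 := by rw [← norm_zpow, h, hc]
  have hpos : 0 < ‖p‖ := norm_pos_iff.2 hp0
  exact hn ((zpow_eq_one_iff_right₀ hpos.le hp1.ne).1 h2)

theorem one_add_zpow_ne_zero {p : 𝕜} (hp0 : p ≠ 0) (hp1 : ‖p‖ < 1) (n : ℤ) :
    1 + p ^ n ≠ 0 := by
  rcases eq_or_ne n 0 with rfl | hn
  · norm_num
  · intro h
    exact zpow_ne_of_norm_eq_one hp0 hp1 (c := -1) (by simp) hn (by linear_combination h)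

theorem one_sub_zpow_ne_zero {p : 𝕜} (hp0 : p ≠ 0) (hp1 : ‖p‖ < 1) {n : ℤ} (hn : n ≠ 0) :
    1 - p ^ n ≠ 0 := by
  intro h
  exact zpow_ne_of_norm_eq_one hp0 hp1 (c := 1) (by simp) hn (by linear_combination -h)

theorem plusCoeff_neg {p : 𝕜} (hp0 : p ≠ 0) (hp1 : ‖p‖ < 1) (n : ℤ) :
    plusCoeff p (-n) = 1 - plusCoeff p n := by
  have h1 := one_add_zpow_ne_zero hp0 hp1 n
  have h2 := zpow_ne_zero n hp0
  have h3 : p ^ n + 1 ≠ 0 := by rwa [add_comm]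
  unfold plusCoeff
  rw [zpow_neg]
  field_simp
  ring

theorem minusCoeff_neg {p : 𝕜} (hp0 : p ≠ 0) (hp1 : ‖p‖ < 1) {n : ℤ} (hn : n ≠ 0) :
    minusCoeff p (-n) = 1 - minusCoeff p n := by
  have h1 := one_sub_zpow_ne_zero hp0 hp1 hn
  have h2 := zpow_ne_zero n hp0
  have h3 : p ^ n - 1 ≠ 0 := fun h => h1 (by linear_combination -h)
  unfold minusCoeff
  rw [zpow_neg]
  field_simp
  ring

/-- The factor `p ^ n` is the source of the geometric decay at negative indices, hence of the inner
radius ‖p‖ of the annulus of convergence. -/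
theorem plusCoeff_neg_eq_mul {p : 𝕜} (hp0 : p ≠ 0) (hp1 : ‖p‖ < 1) (n : ℤ) :
    plusCoeff p (-n) = p ^ n * plusCoeff p n := by
  rw [plusCoeff_neg hp0 hp1]
  have h1 := one_add_zpow_ne_zero hp0 hp1 n
  unfold plusCoeff
  field_simp
  ring

theorem minusCoeff_neg_eq_mul {p : 𝕜} (hp0 : p ≠ 0) (hp1 : ‖p‖ < 1) (n : ℤ) :
    minusCoeff p (-n) = -(p ^ n * minusCoeff p n) := by
  rcases eq_or_ne n 0 with rfl | hn
  · simp [minusCoeff]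
  rw [minusCoeff_neg hp0 hp1 hn]
  have h1 := one_sub_zpow_ne_zero hp0 hp1 hn
  unfold minusCoeff
  field_simp
  ring

theorem norm_plusCoeff_natCast_le {p : 𝕜} (hp1 : ‖p‖ < 1) (n : ℕ) :
    ‖plusCoeff p n‖ ≤ (1 - ‖p‖)⁻¹ := by
  unfold plusCoeff
  rw [norm_inv]
  have hpos : 0 < 1 - ‖p‖ := by linarith
  apply inv_anti₀ hpos
  rcases Nat.eq_zero_or_pos n with rfl | hn
  · have : (1 : 𝕜) + p ^ ((0 : ℕ) : ℤ) = 2 := by norm_num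
    rw [this, RCLike.norm_two]
    linarith [norm_nonneg p]
  · have h1 : ‖p ^ (n : ℤ)‖ ≤ ‖p‖ := by
      rw [zpow_natCast, norm_pow]
      exact pow_le_of_le_one (norm_nonneg _) hp1.le hn.ne'
    have h2 := norm_sub_norm_le (1 : 𝕜) (-p ^ (n : ℤ))
    rw [norm_neg, sub_neg_eq_add, norm_one] at h2
    linarith

theorem norm_minusCoeff_natCast_le {p : 𝕜} (hp1 : ‖p‖ < 1) (n : ℕ) :
    ‖minusCoeff p n‖ ≤ (1 - ‖p‖)⁻¹ := by
  unfold minusCoeff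
  have hpos : 0 < 1 - ‖p‖ := by linarith
  rcases Nat.eq_zero_or_pos n with rfl | hn
  · simpa using hpos.le
  · rw [norm_inv]
    apply inv_anti₀ hpos
    have h1 : ‖p ^ (n : ℤ)‖ ≤ ‖p‖ := by
      rw [zpow_natCast, norm_pow]
      exact pow_le_of_le_one (norm_nonneg _) hp1.le hn.ne'
    have h2 := norm_sub_norm_le (1 : 𝕜) (p ^ (n : ℤ))
    rw [norm_one] at h2
    linarith

theorem norm_plusCoeff_neg_natCast_le {p : 𝕜} (hp0 : p ≠ 0) (hp1 : ‖p‖ < 1) (n : ℕ) :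
    ‖plusCoeff p (-n)‖ ≤ (1 - ‖p‖)⁻¹ * ‖p‖ ^ n := by
  rw [plusCoeff_neg_eq_mul hp0 hp1, norm_mul, zpow_natCast, norm_pow, mul_comm]
  gcongr
  exact norm_plusCoeff_natCast_le hp1 n

theorem norm_minusCoeff_neg_natCast_le {p : 𝕜} (hp0 : p ≠ 0) (hp1 : ‖p‖ < 1) (n : ℕ) :
    ‖minusCoeff p (-n)‖ ≤ (1 - ‖p‖)⁻¹ * ‖p‖ ^ n := by
  rw [minusCoeff_neg_eq_mul hp0 hp1, norm_neg, norm_mul, zpow_natCast, norm_pow, mul_comm]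
  gcongr
  exact norm_minusCoeff_natCast_le hp1 n

theorem summable_norm_laurent {p z : 𝕜} (hp0 : p ≠ 0) (hpz : ‖p‖ < ‖z‖) (hz : ‖z‖ < 1)
    {a : ℤ → 𝕜} {C : ℝ} (h1 : ∀ n : ℕ, ‖a n‖ ≤ C) (h2 : ∀ n : ℕ, ‖a (-n)‖ ≤ C * ‖p‖ ^ n)
    (j : ℕ) : Summable fun n : ℤ => ‖z ^ n * ((n : 𝕜) ^ j * a n)‖ := by
  have hz0 : 0 < ‖z‖ := (norm_nonneg p).trans_lt hpz
  have hr : ‖p‖ / ‖z‖ < 1 := (div_lt_one hz0).2 hpz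
  refine Summable.of_nat_of_neg ?_ ?_
  · refine Summable.of_nonneg_of_le (fun n => norm_nonneg _) (fun n => ?_)
      ((summable_pow_mul_geometric_of_norm_lt_one j
        (show ‖(‖z‖ : ℝ)‖ < 1 by rwa [norm_norm])).mul_left C)
    have := h1 n
    rw [norm_mul, norm_mul, zpow_natCast, norm_pow, norm_pow, Int.cast_natCast,
      RCLike.norm_natCast]
    calc ‖z‖ ^ n * ((n : ℝ) ^ j * ‖a n‖) ≤ ‖z‖ ^ n * ((n : ℝ) ^ j * C) := by gcongr
      _ = C * ((n : ℝ) ^ j * ‖z‖ ^ n) := by ring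
  · refine Summable.of_nonneg_of_le (fun n => norm_nonneg _) (fun n => ?_)
      ((summable_pow_mul_geometric_of_norm_lt_one j (r := ‖p‖ / ‖z‖)
        (by rwa [Real.norm_of_nonneg (by positivity)])).mul_left C)
    have := h2 n
    rw [norm_mul, norm_mul, zpow_neg, zpow_natCast, norm_inv, norm_pow, norm_pow, Int.cast_neg,
      norm_neg, Int.cast_natCast, RCLike.norm_natCast]
    calc (‖z‖ ^ n)⁻¹ * ((n : ℝ) ^ j * ‖a (-n)‖)
        ≤ (‖z‖ ^ n)⁻¹ * ((n : ℝ) ^ j * (C * ‖p‖ ^ n)) := by gcongr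
      _ = C * ((n : ℝ) ^ j * (‖p‖ / ‖z‖) ^ n) := by rw [div_pow]; field_simp

/-- The product of two absolutely convergent Laurent series. -/
theorem hasSum_laurent_mul {z : 𝕜} (hz : z ≠ 0) {a b c : ℤ → 𝕜}
    (ha : Summable fun n : ℤ => ‖z ^ n * a n‖) (hb : Summable fun n : ℤ => ‖z ^ n * b n‖)
    (hc : ∀ N : ℤ, HasSum (fun n : ℤ => a n * b (N - n)) (c N)) :
    HasSum (fun N : ℤ => z ^ N * c N) ((∑' n : ℤ, z ^ n * a n) * ∑' n : ℤ, z ^ n * b n) := by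
  have hs := summable_mul_of_summable_norm ha hb
  have h := hs.hasSum
  rw [← tsum_mul_tsum_of_summable_norm ha hb] at h
  -- The pair (N, n) stands for the exponents n and N - n, so the fibre over N collects the terms in
  -- `z ^ N`.
  let e : ℤ × ℤ ≃ ℤ × ℤ :=
    { toFun := fun x => (x.2, x.1 - x.2)
      invFun := fun x => (x.1 + x.2, x.1)
      left_inv := fun x => by simp
      right_inv := fun x => by simp }
  rw [← e.hasSum_iff] at h
  refine h.prod_fiberwise fun N => ?_
  have : (fun n : ℤ => z ^ N * (a n * b (N - n))) =
      fun n => ((fun x : ℤ × ℤ => z ^ x.1 * a x.1 * (z ^ x.2 * b x.2)) ∘ e) (N, n) := by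
    funext n
    simp only [Function.comp, e, Equiv.coe_fn_mk]
    have : z ^ N = z ^ n * z ^ (N - n) := by rw [← zpow_add₀ hz]; congr 1; ring
    rw [this]
    ring
  rw [← this]
  exact (hc N).mul_left _

/-! ### Sums of differences -/

theorem tendsto_plusCoeff_natCast {p : 𝕜} (hp1 : ‖p‖ < 1) :
    Tendsto (fun n : ℕ => plusCoeff p n) atTop (𝓝 1) := by
  have h : Tendsto (fun n : ℕ => (1 + p ^ n)⁻¹) atTop (𝓝 (1 + 0)⁻¹) :=
    ((tendsto_pow_atTop_nhds_zero_of_norm_lt_one hp1).const_add 1).inv₀ (by simp)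
  simpa [plusCoeff] using h

/-- The difference `s (n + 1) - s n` for `s = plusCoeff p`. -/
noncomputable def plusDiff (p : 𝕜) (n : ℤ) : 𝕜 := plusCoeff p (n + 1) - plusCoeff p n

theorem plusDiff_neg_add_one {p : 𝕜} (hp0 : p ≠ 0) (hp1 : ‖p‖ < 1) (n : ℤ) :
    plusDiff p (-(n + 1)) = plusDiff p n := by
  unfold plusDiff
  rw [plusCoeff_neg hp0 hp1, show -(n + 1) + 1 = -n by ring, plusCoeff_neg hp0 hp1]
  ring

theorem norm_plusDiff_natCast_le {p : 𝕜} (hp0 : p ≠ 0) (hp1 : ‖p‖ < 1) (n : ℕ) :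
    ‖plusDiff p n‖ ≤ 2 * (1 - ‖p‖)⁻¹ * ‖p‖ ^ n := by
  have h : plusDiff p n = plusCoeff p (-(n : ℤ)) - plusCoeff p (-((n + 1 : ℕ) : ℤ)) := by
    unfold plusDiff
    rw [plusCoeff_neg hp0 hp1, plusCoeff_neg hp0 hp1]
    push_cast
    ring
  rw [h]
  refine (norm_sub_le _ _).trans ?_
  have h1 := norm_plusCoeff_neg_natCast_le hp0 hp1 n
  have h2 := norm_plusCoeff_neg_natCast_le hp0 hp1 (n + 1)
  have h3 : (1 - ‖p‖)⁻¹ * ‖p‖ ^ (n + 1) ≤ (1 - ‖p‖)⁻¹ * ‖p‖ ^ n := by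
    have : 0 ≤ (1 - ‖p‖)⁻¹ := inv_nonneg.2 (by linarith)
    exact mul_le_mul_of_nonneg_left
      (pow_le_pow_of_le_one (norm_nonneg _) hp1.le n.le_succ) this
  linarith

theorem summable_natCast_plusDiff {p : 𝕜} (hp0 : p ≠ 0) (hp1 : ‖p‖ < 1) (j : ℕ) :
    Summable fun n : ℕ => (n : 𝕜) ^ j * plusDiff p n := by
  refine Summable.of_norm_bounded
    ((summable_pow_mul_geometric_of_norm_lt_one j
        (show ‖(‖p‖ : ℝ)‖ < 1 by rwa [norm_norm])).mul_left (2 * (1 - ‖p‖)⁻¹)) fun n => ?_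
  have := norm_plusDiff_natCast_le hp0 hp1 n
  rw [norm_mul, norm_pow, RCLike.norm_natCast]
  calc (n : ℝ) ^ j * ‖plusDiff p n‖ ≤ (n : ℝ) ^ j * (2 * (1 - ‖p‖)⁻¹ * ‖p‖ ^ n) := by gcongr
    _ = _ := by ring

theorem hasSum_natCast_plusDiff {p : 𝕜} (hp0 : p ≠ 0) (hp1 : ‖p‖ < 1) :
    HasSum (fun n : ℕ => plusDiff p n) (1 / 2) := by
  have hs : Summable fun n : ℕ => plusDiff p n := by
    simpa using summable_natCast_plusDiff hp0 hp1 0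
  rw [hs.hasSum_iff_tendsto_nat]
  have h : ∀ n : ℕ, ∑ i ∈ Finset.range n, plusDiff p i = plusCoeff p n - 1 / 2 := by
    intro n
    have := Finset.sum_range_sub (fun i : ℕ => plusCoeff p i) n
    simp only [plusDiff]
    push_cast at this
    rw [this]
    congr 1
    simp [plusCoeff]
    norm_num
  simp only [h]
  have := (tendsto_plusCoeff_natCast hp1).sub_const (1 / 2 : 𝕜)
  convert this using 2
  norm_num

theorem hasSum_plusDiff {p : 𝕜} (hp0 : p ≠ 0) (hp1 : ‖p‖ < 1) :
    HasSum (fun n : ℤ => plusDiff p n) 1 := by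
  have h := hasSum_natCast_plusDiff hp0 hp1
  have h2 := HasSum.of_nat_of_neg_add_one (f := fun n : ℤ => plusDiff p n) h
    (m' := 1 / 2) (by simpa only [plusDiff_neg_add_one hp0 hp1] using h)
  exact h2.of_eq (fun _ => rfl) (by norm_num)

/-- The differences are symmetric under n ↦ -(n+1), and n and -(n+1) add up to -1; the value is
therefore -1/2 times the total sum 1. -/
theorem hasSum_intCast_mul_plusDiff {p : 𝕜} (hp0 : p ≠ 0) (hp1 : ‖p‖ < 1) :
    HasSum (fun n : ℤ => (n : 𝕜) * plusDiff p n) (-(1 / 2)) := by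
  have h1 : Summable fun n : ℕ => (n : 𝕜) * plusDiff p n := by
    simpa using summable_natCast_plusDiff hp0 hp1 1
  obtain ⟨A, hA⟩ := h1
  have h := hasSum_natCast_plusDiff hp0 hp1
  have h2 := HasSum.of_nat_of_neg_add_one (f := fun n : ℤ => (n : 𝕜) * plusDiff p n)
    (m := A) (m' := -A - 1 / 2) (by simpa using hA) (by
      have := hA.neg.sub h
      refine this.of_eq (fun n => ?_) rfl
      rw [plusDiff_neg_add_one hp0 hp1]
      push_cast
      ring)
  exact h2.of_eq (fun _ => rfl) (by ring)

/-- Each unit shift contributes the total increase of `plusCoeff p` from 0 at -∞ to 1 at +∞. -/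
theorem hasSum_plusCoeff_sub {p : 𝕜} (hp0 : p ≠ 0) (hp1 : ‖p‖ < 1) (N : ℤ) :
    HasSum (fun n : ℤ => plusCoeff p n - plusCoeff p (n - N)) (N : 𝕜) := by
  have hd : ∀ M : ℤ, HasSum (fun n : ℤ => plusCoeff p (n - M) - plusCoeff p (n - (M + 1))) 1 := by
    intro M
    have h := (Equiv.subRight (M + 1)).hasSum_iff.2 (hasSum_plusDiff hp0 hp1)
    convert h using 2 with n
    simp only [Function.comp, Equiv.subRight_apply, plusDiff]
    rw [show n - (M + 1) + 1 = n - M by ring]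
  induction N using Int.induction_on with
  | zero => simp
  | succ i ih =>
    exact (ih.add (hd i)).of_eq (fun n => by ring) (by push_cast; ring)
  | pred i ih =>
    refine (ih.sub (hd (-i - 1))).of_eq (fun n => ?_) ?_
    · rw [show n - (-(i : ℤ) - 1 + 1) = n - -(i : ℤ) by ring]
      ring
    · push_cast
      ring

/-- Partial fractions: with a = pⁿ and b = p^(N-n), the product 1/((1+a)(1+b)) splits with common
factor 1/(1-ab), which no longer depends on n. -/
theorem plusCoeff_mul_plusCoeff {p : 𝕜} (hp0 : p ≠ 0) (hp1 : ‖p‖ < 1) (n N : ℤ) (hN : N ≠ 0) :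
    plusCoeff p n * plusCoeff p (N - n) =
      minusCoeff p N * (plusCoeff p n - plusCoeff p (n - N)) := by
  have h0 := one_sub_zpow_ne_zero hp0 hp1 hN
  have h1 := one_add_zpow_ne_zero hp0 hp1 n
  have h2 := one_add_zpow_ne_zero hp0 hp1 (N - n)
  rw [show n - N = -(N - n) by ring, plusCoeff_neg hp0 hp1]
  have h3 : p ^ N = p ^ n * p ^ (N - n) := by rw [← zpow_add₀ hp0]; congr 1; ring
  unfold plusCoeff minusCoeff
  rw [h3] at h0 ⊢
  generalize p ^ (N - n) = b at *
  generalize p ^ n = a at *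
  field_simp
  ring

theorem plusCoeff_mul_minusCoeff {p : 𝕜} (hp0 : p ≠ 0) (hp1 : ‖p‖ < 1) (m N : ℤ) (hm : m ≠ 0) :
    plusCoeff p (N - m) * minusCoeff p m =
      plusCoeff p N * (plusCoeff p (N - m) - minusCoeff p (-m)) := by
  have h0 := one_add_zpow_ne_zero hp0 hp1 N
  have h1 := one_sub_zpow_ne_zero hp0 hp1 hm
  have h2 := one_add_zpow_ne_zero hp0 hp1 (N - m)
  rw [minusCoeff_neg hp0 hp1 hm]
  have h3 : p ^ N = p ^ m * p ^ (N - m) := by rw [← zpow_add₀ hp0]; congr 1; ring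
  unfold plusCoeff minusCoeff
  rw [h3] at h0 ⊢
  generalize p ^ (N - m) = b at *
  generalize p ^ m = a at *
  rw [eq_comm, inv_mul_eq_iff_eq_mul₀ h0]
  field_simp
  ring

theorem summable_plusCoeff_mul_neg {p : 𝕜} (hp0 : p ≠ 0) (hp1 : ‖p‖ < 1) :
    Summable fun n : ℤ => plusCoeff p n * plusCoeff p (-n) := by
  have h : Summable fun n : ℕ => plusCoeff p n * plusCoeff p (-n) := by
    refine Summable.of_norm_bounded
      ((summable_geometric_of_norm_lt_one (show ‖(‖p‖ : ℝ)‖ < 1 by rwa [norm_norm])).mul_left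
        ((1 - ‖p‖)⁻¹ * (1 - ‖p‖)⁻¹)) fun n => ?_
    have h1 := norm_plusCoeff_natCast_le hp1 n
    have h2 := norm_plusCoeff_neg_natCast_le hp0 hp1 n
    have h3 : 0 ≤ (1 - ‖p‖)⁻¹ := inv_nonneg.2 (by linarith)
    rw [norm_mul, mul_assoc]
    gcongr
  exact Summable.of_nat_of_neg h (by simpa [mul_comm] using h)

/-- Passing from N to N + 1 changes the sum by N + 1/2, and these increments add up to N²/2. The
value T at N = 0 is left as an unknown constant. -/
theorem exists_hasSum_mul_plusCoeff_sub_minusCoeff {p : 𝕜} (hp0 : p ≠ 0) (hp1 : ‖p‖ < 1) :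
    ∃ T : 𝕜, ∀ N : ℤ,
      HasSum (fun m : ℤ => (m : 𝕜) * (plusCoeff p (N - m) - minusCoeff p (-m)))
        (T + (N : 𝕜) ^ 2 / 2) := by
  have h : Summable fun n : ℕ => (n : 𝕜) * (plusCoeff p (-n) - minusCoeff p (-n)) := by
    refine Summable.of_norm_bounded
      ((summable_pow_mul_geometric_of_norm_lt_one 1
        (show ‖(‖p‖ : ℝ)‖ < 1 by rwa [norm_norm])).mul_left (2 * (1 - ‖p‖)⁻¹)) fun n => ?_
    have h1 := norm_minusCoeff_neg_natCast_le hp0 hp1 n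
    have h2 := norm_plusCoeff_neg_natCast_le hp0 hp1 n
    rw [norm_mul, RCLike.norm_natCast, pow_one]
    calc (n : ℝ) * ‖plusCoeff p (-n) - minusCoeff p (-n)‖
        ≤ n * (2 * (1 - ‖p‖)⁻¹ * ‖p‖ ^ n) := by
          gcongr
          refine (norm_sub_le _ _).trans ?_
          linarith
      _ = _ := by ring
  have h0 : Summable fun m : ℤ => (m : 𝕜) * (plusCoeff p (0 - m) - minusCoeff p (-m)) := by
    refine Summable.of_nat_of_neg (by simpa using h) ?_
    refine h.congr fun n => ?_
    rcases Nat.eq_zero_or_pos n with rfl | hn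
    · simp
    · have hn' : (n : ℤ) ≠ 0 := by exact_mod_cast hn.ne'
      rw [plusCoeff_neg hp0 hp1 n, minusCoeff_neg hp0 hp1 hn', neg_neg, zero_sub, neg_neg]
      push_cast
      ring
  obtain ⟨T, hT⟩ := h0
  refine ⟨T, fun N => ?_⟩
  have hd : ∀ M : ℤ, HasSum (fun m : ℤ => (m : 𝕜) * (plusCoeff p (M + 1 - m) -
      plusCoeff p (M - m))) (M + 1 / 2) := by
    intro M
    have h1 := ((hasSum_plusDiff hp0 hp1).mul_left (M : 𝕜)).sub
      (hasSum_intCast_mul_plusDiff hp0 hp1)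
    have h2 := (Equiv.subLeft M).hasSum_iff.2 h1
    refine h2.of_eq (fun m => ?_) ?_
    · simp only [Function.comp, Equiv.subLeft_apply, plusDiff]
      rw [show M - m + 1 = M + 1 - m by ring]
      push_cast
      ring
    · ring
  induction N using Int.induction_on with
  | zero => simpa using hT
  | succ i ih =>
    refine (ih.add (hd i)).of_eq (fun m => ?_) ?_
    · ring
    · push_cast
      ring
  | pred i ih =>
    refine (ih.sub (hd (-i - 1))).of_eq (fun m => ?_) ?_
    · rw [show -(i : ℤ) - 1 + 1 - m = -(i : ℤ) - m by ring]
      ring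
    · push_cast
      ring

/-- The square of `∑ z ^ n / (1 + p ^ n)`. -/
theorem hasSum_sq_tsum_plusCoeff {p z : 𝕜} (hp0 : p ≠ 0) (hpz : ‖p‖ < ‖z‖) (hz : ‖z‖ < 1) :
    HasSum (fun N : ℤ => z ^ N * (N * minusCoeff p N))
      ((∑' n : ℤ, z ^ n * plusCoeff p n) ^ 2 - ∑' n : ℤ, plusCoeff p n * plusCoeff p (-n)) := by
  have hp1 := hpz.trans hz
  have hz0 : z ≠ 0 := norm_pos_iff.1 ((norm_nonneg p).trans_lt hpz)
  have hs : Summable fun n : ℤ => ‖z ^ n * plusCoeff p n‖ := by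
    simpa using summable_norm_laurent hp0 hpz hz (norm_plusCoeff_natCast_le hp1)
      (norm_plusCoeff_neg_natCast_le hp0 hp1) 0
  set κ := ∑' n : ℤ, plusCoeff p n * plusCoeff p (-n) with hκ
  -- The coefficient at N = 0 is exceptional: there `minusCoeff p 0 = 0`, and the convolution equals
  -- κ.
  have h := hasSum_laurent_mul hz0 hs hs
    (c := fun N => N * minusCoeff p N + if N = 0 then κ else 0) (fun N => ?_)
  · have h2 := h.sub (hasSum_ite_eq (0 : ℤ) κ)
    rw [← sq] at h2
    refine h2.of_eq (fun N => ?_) rfl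
    split_ifs with hN <;> simp [hN]
  · rcases eq_or_ne N 0 with rfl | hN
    · simpa using (summable_plusCoeff_mul_neg hp0 hp1).hasSum
    · simp only [plusCoeff_mul_plusCoeff hp0 hp1 _ N hN, hN, if_false, add_zero]
      rw [mul_comm (N : 𝕜)]
      exact (hasSum_plusCoeff_sub hp0 hp1 N).mul_left _

/-- The product of `∑ z ^ n / (1 + p ^ n)` and `∑ n z ^ n / (1 - p ^ n)`. -/
theorem exists_hasSum_tsum_plusCoeff_mul {p : 𝕜} (hp0 : p ≠ 0) :
    ∃ T : 𝕜, ∀ z : 𝕜, ‖p‖ < ‖z‖ → ‖z‖ < 1 →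
      (∑' n : ℤ, z ^ n * plusCoeff p n) * (∑' n : ℤ, z ^ n * (n * minusCoeff p n)) =
        T * (∑' n : ℤ, z ^ n * plusCoeff p n) +
          1 / 2 * ∑' n : ℤ, z ^ n * ((n : 𝕜) ^ 2 * plusCoeff p n) := by
  rcases le_or_gt 1 ‖p‖ with hp1 | hp1
  · exact ⟨0, fun z h1 h2 => absurd (h1.trans h2) hp1.not_gt⟩
  obtain ⟨T, hT⟩ := exists_hasSum_mul_plusCoeff_sub_minusCoeff hp0 hp1
  refine ⟨T, fun z hpz hz => ?_⟩
  have hz0 : z ≠ 0 := norm_pos_iff.1 ((norm_nonneg p).trans_lt hpz)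
  have hs : ∀ j, Summable fun n : ℤ => ‖z ^ n * ((n : 𝕜) ^ j * plusCoeff p n)‖ :=
    summable_norm_laurent hp0 hpz hz (norm_plusCoeff_natCast_le hp1)
      (norm_plusCoeff_neg_natCast_le hp0 hp1)
  have hs0 : Summable fun n : ℤ => ‖z ^ n * plusCoeff p n‖ := by simpa using hs 0
  have hr : Summable fun n : ℤ => ‖z ^ n * (n * minusCoeff p n)‖ := by
    simpa using summable_norm_laurent hp0 hpz hz (norm_minusCoeff_natCast_le hp1)
      (norm_minusCoeff_neg_natCast_le hp0 hp1) 1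
  have h := hasSum_laurent_mul hz0 hr hs0
    (c := fun N => plusCoeff p N * (T + (N : 𝕜) ^ 2 / 2)) (fun N => ?_)
  · have h2 := (hs0.of_norm.hasSum.mul_left T).add ((hs 2).of_norm.hasSum.mul_left (1 / 2))
    rw [mul_comm, ← h.tsum_eq, ← h2.tsum_eq]
    congr 1
    funext N
    ring
  · have h2 := (hT N).mul_left (plusCoeff p N)
    refine h2.of_eq (fun m => ?_) rfl
    rcases eq_or_ne m 0 with rfl | hm
    · simp
    · rw [mul_assoc, mul_comm (minusCoeff p m), plusCoeff_mul_minusCoeff hp0 hp1 m N hm]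
      ring

end Bilateral

/-! ### Sums of two squares -/

theorem summable_zpow_sq {z : ℝ} (hz0 : z ≠ 0) (hz1 : |z| < 1) :
    Summable fun n : ℤ => ‖z ^ (n ^ 2)‖ := by
  simpa using squareSeries_summable (abs_pos.2 hz0) hz1

theorem summable_pow_natAbs {r : ℝ} (h0 : 0 ≤ r) (h1 : r < 1) :
    Summable fun n : ℤ => r ^ n.natAbs := by
  have h := summable_geometric_of_lt_one h0 h1
  exact Summable.of_nat_of_neg (by simpa using h) (by simpa using h)

theorem tendsto_tsum_int_of_le_pow_natAbs {f : ℝ → ℤ → ℝ} {c : ℝ}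
    (h : ∀ x, 0 < x → x < 1 → ∀ n, |f x n| ≤ x ^ n.natAbs)
    (h0 : ∀ x, 0 < x → x < 1 → f x 0 = c) :
    Tendsto (fun x => ∑' n, f x n) (𝓝[>] 0) (𝓝 c) := by
  have hev : ∀ᶠ x : ℝ in 𝓝[>] 0, 0 < x ∧ x < 1 / 2 := by
    exact Ioo_mem_nhdsGT (by norm_num)
  have := tendsto_tsum_of_dominated_convergence (𝓕 := 𝓝[>] (0 : ℝ)) (f := f)
    (g := fun n => if n = 0 then c else 0) (bound := fun n : ℤ => (1 / 2 : ℝ) ^ n.natAbs)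
    (summable_pow_natAbs (by norm_num) (by norm_num)) (fun n => ?_) ?_
  · simpa using this
  · split_ifs with hn
    · subst hn
      refine tendsto_const_nhds.congr' ?_
      filter_upwards [hev] with x hx
      exact (h0 x hx.1 (by linarith [hx.2])).symm
    · have hlim : Tendsto (fun x : ℝ => x ^ n.natAbs) (𝓝[>] 0) (𝓝 0) := by
        have : Tendsto (fun x : ℝ => x ^ n.natAbs) (𝓝 0) (𝓝 (0 ^ n.natAbs)) :=
          (continuous_pow _).tendsto 0
        rw [zero_pow (by simpa using hn)] at this
        exact this.mono_left nhdsWithin_le_nhds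
      refine squeeze_zero_norm' ?_ hlim
      filter_upwards [hev] with x hx
      exact h x hx.1 (by linarith [hx.2]) n
  · filter_upwards [hev] with x hx n
    exact (h x hx.1 (by linarith [hx.2]) n).trans (pow_le_pow_left₀ hx.1.le hx.2.le _)

/-- The bilateral Lambert series `∑ z ^ n / (1 + z ^ (2 * n))`. -/
noncomputable def twoSquareLambert (z : ℝ) : ℝ := ∑' n : ℤ, z ^ n * plusCoeff (z ^ 2) n

theorem summable_twoSquareLambert {z : ℝ} (hz0 : z ≠ 0) (hz1 : |z| < 1) :
    Summable fun n : ℤ => ‖z ^ n * plusCoeff (z ^ 2) n‖ := by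
  have hp : ‖z ^ 2‖ < ‖z‖ := by
    rw [norm_pow, Real.norm_eq_abs]
    nlinarith [abs_pos.2 hz0]
  simpa using summable_norm_laurent (pow_ne_zero 2 hz0) hp hz1
    (norm_plusCoeff_natCast_le (hp.trans hz1))
    (norm_plusCoeff_neg_natCast_le (pow_ne_zero 2 hz0) (hp.trans hz1)) 0

theorem mul_sub_one_ge_natAbs (n : ℤ) : (n.natAbs : ℤ) - 1 ≤ n * (n - 1) := by
  rcases le_or_gt n 0 with h | h
  · rw [Int.ofNat_natAbs_of_nonpos h]
    nlinarith
  · rw [Int.natAbs_of_nonneg h.le]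
    nlinarith

theorem summable_alternating_theta {z : ℝ} (hz0 : z ≠ 0) (hz1 : |z| < 1) :
    Summable fun n : ℤ => ‖(-1 : ℝ) ^ n * z ^ (n * (n - 1))‖ := by
  have hp := abs_pos.2 hz0
  refine Summable.of_nonneg_of_le (fun _ => norm_nonneg _) (fun n => ?_)
    ((summable_pow_natAbs hp.le hz1).mul_left |z|⁻¹)
  rw [norm_mul, norm_zpow, norm_zpow, norm_neg, norm_one, one_zpow, one_mul, Real.norm_eq_abs]
  calc |z| ^ (n * (n - 1)) ≤ |z| ^ ((n.natAbs : ℤ) - 1) :=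
        zpow_le_zpow_right_of_le_one₀ hp hz1.le (mul_sub_one_ge_natAbs n)
    _ = |z|⁻¹ * |z| ^ n.natAbs := by
        rw [zpow_sub_one₀ hp.ne', zpow_natCast, mul_comm]

/-- The reflection n ↦ 1 - n preserves n(n-1) and reverses the sign. -/
theorem tsum_alternating_theta {z : ℝ} :
    ∑' n : ℤ, (-1 : ℝ) ^ n * z ^ (n * (n - 1)) = 0 := by
  have h := (Equiv.subLeft (1 : ℤ)).tsum_eq fun n : ℤ => (-1 : ℝ) ^ n * z ^ (n * (n - 1))
  have h2 : ∀ n : ℤ, (-1 : ℝ) ^ (Equiv.subLeft (1 : ℤ) n) *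
      z ^ ((Equiv.subLeft (1 : ℤ) n) * ((Equiv.subLeft (1 : ℤ) n) - 1)) =
      -((-1 : ℝ) ^ n * z ^ (n * (n - 1))) := by
    intro n
    rw [Equiv.subLeft_apply, zpow_sub₀ (by norm_num), zpow_one,
      show (1 - n) * (1 - n - 1) = n * (n - 1) by ring]
    rcases Int.even_or_odd n with hn | hn
    · rw [hn.neg_one_zpow]; ring
    · rw [hn.neg_one_zpow]; ring
  simp only [h2, tsum_neg] at h
  linarith

/-- The coefficients of the product of ∑ (-z)^(n²) w^n-type weights are governed by a first order
recurrence, which forces them to be those of a theta series up to the factor `c 0`. What matters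
later is that this factor is unchanged under z ↦ -z. -/
theorem squareSeries_neg_mul_twoSquareLambert {z : ℝ} (hz0 : z ≠ 0) (hz1 : |z| < 1) :
    squareSeries (-z) * twoSquareLambert z =
      (∑' n : ℤ, (-1 : ℝ) ^ n * z ^ (n * (n - 1)) * plusCoeff (z ^ 2) (-n)) * squareSeries z := by
  have hp0 : z ^ 2 ≠ 0 := pow_ne_zero 2 hz0
  have hp1 : ‖z ^ 2‖ < 1 := by
    rw [norm_pow, Real.norm_eq_abs]
    nlinarith [abs_nonneg z]
  set e : ℤ → ℝ := fun n => (-1 : ℝ) ^ n * z ^ (n * (n - 1)) with he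
  have hes : Summable fun n => ‖e n‖ := summable_alternating_theta hz0 hz1
  have hpar : ∀ n : ℤ, z ^ n * e n = (-z) ^ (n ^ 2) := by
    intro n
    have h1 : (-z) ^ (n ^ 2) = (-1) ^ (n ^ 2) * z ^ (n ^ 2) := by rw [← mul_zpow]; ring_nf
    have h2 : (-1 : ℝ) ^ (n ^ 2) = (-1) ^ n := by
      rcases Int.even_or_odd n with hn | hn
      · rw [hn.neg_one_zpow, (hn.pow_of_ne_zero two_ne_zero).neg_one_zpow]
      · rw [hn.neg_one_zpow, (hn.pow).neg_one_zpow]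
    rw [h1, h2, he]
    simp only
    rw [mul_left_comm, ← zpow_add₀ hz0]
    ring_nf
  have hbd : ∀ n : ℤ, ‖plusCoeff (z ^ 2) n‖ ≤ (1 - ‖z ^ 2‖)⁻¹ := by
    intro n
    obtain ⟨k, rfl | rfl⟩ := n.eq_nat_or_neg
    · exact norm_plusCoeff_natCast_le hp1 k
    · refine (norm_plusCoeff_neg_natCast_le hp0 hp1 k).trans ?_
      exact mul_le_of_le_one_right (inv_nonneg.2 (by linarith))
        (pow_le_one₀ (norm_nonneg _) hp1.le)
  have hs : ∀ N : ℤ, Summable fun n => e n * plusCoeff (z ^ 2) (N - n) := fun N =>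
    Summable.of_norm_bounded (hes.mul_right (1 - ‖z ^ 2‖)⁻¹) fun n => by
      rw [norm_mul]
      exact mul_le_mul_of_nonneg_left (hbd _) (norm_nonneg _)
  set c : ℤ → ℝ := fun N => ∑' n, e n * plusCoeff (z ^ 2) (N - n) with hc
  -- Since ∑ e n = 0, the weight 1/(1+x) in c N may be replaced by -(1 - 1/(1+x)) = -x/(1+x), with x
  -- = z^(2(N-n)); the factor x is absorbed by shifting e by one index.
  have hrec : ∀ N : ℤ, c N = (z ^ 2) ^ (N - 1) * c (N - 1) := by
    intro N
    have h1 : ∀ n : ℤ, e n - e n * plusCoeff (z ^ 2) (N - n) =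
        -((z ^ 2) ^ (N - 1) * (e (n - 1) * plusCoeff (z ^ 2) (N - 1 - (n - 1)))) := by
      intro n
      have h2 : 1 - plusCoeff (z ^ 2) (N - n) =
          (z ^ 2) ^ (N - n) * plusCoeff (z ^ 2) (N - n) := by
        rw [← plusCoeff_neg_eq_mul hp0 hp1, plusCoeff_neg hp0 hp1]
      have h3 : e n * (z ^ 2) ^ (N - n) = -((z ^ 2) ^ (N - 1) * e (n - 1)) := by
        simp only [he]
        rw [zpow_sub₀ (show (-1 : ℝ) ≠ 0 by norm_num), ← zpow_natCast, ← zpow_mul, ← zpow_mul]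
        have h4 : z ^ (n * (n - 1)) * z ^ (((2 : ℕ) : ℤ) * (N - n)) =
            z ^ (((2 : ℕ) : ℤ) * (N - 1)) * z ^ ((n - 1) * (n - 1 - 1)) := by
          rw [← zpow_add₀ hz0, ← zpow_add₀ hz0]
          congr 1
          push_cast
          ring
        rw [mul_assoc, h4]
        ring
      rw [show N - 1 - (n - 1) = N - n by ring]
      linear_combination e n * h2 + plusCoeff (z ^ 2) (N - n) * h3
    have h5 := (hes.of_norm.tsum_sub (hs N)).symm
    simp only [h1, tsum_neg, tsum_mul_left] at h5
    have h6 := (Equiv.subRight (1 : ℤ)).tsum_eq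
      fun n => e n * plusCoeff (z ^ 2) (N - 1 - n)
    simp only [Equiv.subRight_apply] at h6
    have h7 : ∑' n, e n = 0 := tsum_alternating_theta
    rw [h6, h7] at h5
    simp only [hc]
    linarith
  have hcN : ∀ N : ℤ, c N = c 0 * z ^ (N * (N - 1)) := by
    have key : ∀ N : ℤ, z ^ ((N + 1) * (N + 1 - 1)) = (z ^ 2) ^ N * z ^ (N * (N - 1)) := by
      intro N
      rw [← zpow_natCast, ← zpow_mul, ← zpow_add₀ hz0]
      congr 1
      push_cast
      ring
    intro N
    induction N using Int.induction_on with
    | zero => simp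
    | succ i ih =>
      rw [key, hrec, add_sub_cancel_right, ih]
      ring
    | pred i ih =>
      have h1 := hrec (-i)
      have h2 := key (-(i : ℤ) - 1)
      rw [sub_add_cancel] at h2
      rw [ih, h2] at h1
      have h3 : (z ^ 2) ^ (-(i : ℤ) - 1) ≠ 0 := zpow_ne_zero _ hp0
      apply mul_left_cancel₀ h3
      rw [← h1]
      ring
  have h := hasSum_laurent_mul hz0 (a := e) (b := plusCoeff (z ^ 2)) (c := c)
    (by simp only [hpar]; exact summable_zpow_sq (neg_ne_zero.2 hz0) (by rwa [abs_neg]))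
    (summable_twoSquareLambert hz0 hz1) (fun N => (hs N).hasSum)
  have h2 : ∀ N : ℤ, z ^ N * c N = c 0 * z ^ (N ^ 2) := by
    intro N
    rw [hcN, mul_left_comm, ← zpow_add₀ hz0]
    ring_nf
  simp only [h2, hpar] at h
  have h3 := h.tsum_eq
  rw [tsum_mul_left] at h3
  simp only [hc, zero_sub] at h3
  exact h3.symm

/-- Use the preceding identity at z and at -z, and eliminate the common even factor. -/
theorem squareSeries_neg_sq_mul {z : ℝ} (hz0 : z ≠ 0) (hz1 : |z| < 1) :
    squareSeries (-z) ^ 2 * twoSquareLambert z =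
      squareSeries z ^ 2 * twoSquareLambert (-z) := by
  have h1 := squareSeries_neg_mul_twoSquareLambert hz0 hz1
  have h2 := squareSeries_neg_mul_twoSquareLambert (neg_ne_zero.2 hz0) (by rwa [abs_neg])
  have h3 : ∀ n : ℤ, (-z) ^ (n * (n - 1)) = z ^ (n * (n - 1)) := fun n =>
    (Int.even_mul_pred_self n).neg_zpow z
  simp only [neg_neg, neg_sq, h3] at h2
  linear_combination squareSeries (-z) * h1 - squareSeries z * h2

/-- Odd exponents cancel, and the even exponents reproduce the series at z². -/
theorem twoSquareLambert_add_neg {z : ℝ} (hz0 : z ≠ 0) (hz1 : |z| < 1) :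
    twoSquareLambert z + twoSquareLambert (-z) = 2 * twoSquareLambert (z ^ 2) := by
  have h1 := (summable_twoSquareLambert hz0 hz1).of_norm
  have h2 := (summable_twoSquareLambert (neg_ne_zero.2 hz0) (by rwa [abs_neg])).of_norm
  unfold twoSquareLambert
  rw [← h1.tsum_add h2, ← tsum_mul_left]
  have hinj : Function.Injective fun n : ℤ => 2 * n := fun a b h => by
    simp only at h
    omega
  rw [← hinj.tsum_eq]
  · congr 1
    funext n
    rw [(even_two_mul n).neg_zpow, neg_sq]
    have : z ^ (2 * n) = (z ^ 2) ^ n := by rw [zpow_mul]; norm_cast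
    have h4 : plusCoeff (z ^ 2) (2 * n) = plusCoeff ((z ^ 2) ^ 2) n := by
      unfold plusCoeff
      rw [zpow_mul]
      norm_cast
    rw [this, h4]
    ring
  · intro n hn
    rw [Function.mem_support] at hn
    rcases Int.even_or_odd' n with ⟨k, rfl | rfl⟩
    · exact ⟨k, rfl⟩
    · exfalso
      apply hn
      rw [(odd_two_mul_add_one k).neg_zpow, neg_sq]
      ring

/-- Only pairs (a, b) with a² + b² even survive; these are exactly the pairs (x+y, x-y), for which
a² + b² = 2(x² + y²). -/
theorem squareSeries_sq_add_neg {z : ℝ} (hz0 : z ≠ 0) (hz1 : |z| < 1) :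
    squareSeries z ^ 2 + squareSeries (-z) ^ 2 = 2 * squareSeries (z ^ 2) ^ 2 := by
  have hm0 : -z ≠ 0 := neg_ne_zero.2 hz0
  have hm1 : |-z| < 1 := by rwa [abs_neg]
  have hq0 : z ^ 2 ≠ 0 := pow_ne_zero 2 hz0
  have hq1 : |z ^ 2| < 1 := by
    rw [abs_pow]
    nlinarith [abs_nonneg z]
  have hsq : ∀ {x : ℝ}, x ≠ 0 → |x| < 1 → HasSum (fun n : ℤ × ℤ => x ^ (n.1 ^ 2 + n.2 ^ 2))
      (squareSeries x ^ 2) := by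
    intro x h0 h1
    have hs := summable_zpow_sq h0 h1
    have h := (summable_mul_of_summable_norm hs hs).hasSum
    rw [← tsum_mul_tsum_of_summable_norm hs hs] at h
    exact h.of_eq (fun n => zpow_add₀ h0 _ _) (sq _)
  have h := ((hsq hz0 hz1).add (hsq hm0 hm1)).tsum_eq
  rw [← h, ← (hsq hq0 hq1).tsum_eq, ← tsum_mul_left]
  have hinj : Function.Injective fun n : ℤ × ℤ => (n.1 + n.2, n.1 - n.2) := fun a b h => by
    simp only [Prod.mk.injEq] at h
    ext <;> omega
  rw [← hinj.tsum_eq]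
  · congr 1
    funext n
    have h1 : (n.1 + n.2) ^ 2 + (n.1 - n.2) ^ 2 = 2 * (n.1 ^ 2 + n.2 ^ 2) := by ring
    simp only
    rw [h1, (even_two_mul _).neg_zpow, zpow_mul]
    norm_cast
    ring
  · intro n hn
    rw [Function.mem_support] at hn
    rcases Int.even_or_odd (n.1 ^ 2 + n.2 ^ 2) with h1 | h1
    · have h2 : Even (n.1 + n.2) := by
        simpa [Int.even_add, Int.even_pow] using h1
      obtain ⟨k, hk⟩ := h2
      exact ⟨(k, n.1 - k), by ext <;> simp; omega⟩
    · exfalso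
      apply hn
      rw [h1.neg_zpow]
      ring

theorem tendsto_squareSeries : Tendsto squareSeries (𝓝[>] 0) (𝓝 1) := by
  refine tendsto_tsum_int_of_le_pow_natAbs (f := fun x n => x ^ (n ^ 2)) (fun x h0 h1 n => ?_)
    (fun x _ _ => by simp)
  rw [abs_of_nonneg (zpow_nonneg h0.le _), ← Int.natAbs_sq, ← Nat.cast_pow, zpow_natCast]
  exact pow_le_pow_of_le_one h0.le h1.le (Nat.le_self_pow two_ne_zero _)

theorem tendsto_twoSquareLambert : Tendsto twoSquareLambert (𝓝[>] 0) (𝓝 (1 / 2)) := by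
  refine tendsto_tsum_int_of_le_pow_natAbs (f := fun x n => x ^ n * plusCoeff (x ^ 2) n)
    (fun x h0 h1 n => ?_) (fun x _ _ => by simp [plusCoeff]; norm_num)
  have hnat : ∀ k : ℕ, x ^ k * plusCoeff (x ^ 2) k ≤ x ^ k := by
    intro k
    refine mul_le_of_le_one_right (pow_nonneg h0.le _) ?_
    unfold plusCoeff
    rw [zpow_natCast]
    exact inv_le_one_of_one_le₀ (by linarith [pow_nonneg (sq_nonneg x) k])
  rw [abs_of_nonneg (by unfold plusCoeff; positivity)]
  obtain ⟨k, rfl | rfl⟩ := n.eq_nat_or_neg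
  · simpa using hnat k
  · rw [plusCoeff_neg_eq_mul (by positivity) (by
      rw [Real.norm_of_nonneg (by positivity)]; nlinarith)]
    have : x ^ (-(k : ℤ)) * ((x ^ 2) ^ (k : ℤ) * plusCoeff (x ^ 2) k) =
        x ^ k * plusCoeff (x ^ 2) k := by
      rw [zpow_neg, zpow_natCast, zpow_natCast]
      field_simp
      ring
    rw [this]
    simpa using hnat k

theorem squareSeries_pos {q : ℝ} (h0 : 0 < q) (h1 : q < 1) : 0 < squareSeries q :=
  (squareSeries_summable h0 h1).tsum_pos (fun _ => zpow_nonneg h0.le _) 0 (by simp)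

/-- The generating function of the numbers of representations by two squares. -/
theorem squareSeries_sq {q : ℝ} (h0 : 0 < q) (h1 : q < 1) :
    squareSeries q ^ 2 = 2 * twoSquareLambert q := by
  -- The three preceding relations between x, -x and x² eliminate the values at -x.
  have step : ∀ x : ℝ, 0 < x → x < 1 → twoSquareLambert x / squareSeries x ^ 2 =
      twoSquareLambert (x ^ 2) / squareSeries (x ^ 2) ^ 2 := by
    intro x hx0 hx1
    have hx2 : x ^ 2 < 1 := by nlinarith
    have ha : |x| < 1 := by rwa [abs_of_pos hx0]
    have e1 := squareSeries_neg_sq_mul hx0.ne' ha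
    have e2 := twoSquareLambert_add_neg hx0.ne' ha
    have e3 := squareSeries_sq_add_neg hx0.ne' ha
    rw [div_eq_div_iff (pow_pos (squareSeries_pos hx0 hx1) 2).ne'
      (pow_pos (squareSeries_pos (pow_pos hx0 2) hx2) 2).ne']
    linear_combination 1 / 2 * e1 + 1 / 2 * squareSeries x ^ 2 * e2 -
      1 / 2 * twoSquareLambert x * e3
  have iter : ∀ n : ℕ, twoSquareLambert q / squareSeries q ^ 2 =
      twoSquareLambert (q ^ 2 ^ n) / squareSeries (q ^ 2 ^ n) ^ 2 := by
    intro n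
    induction n with
    | zero => simp
    | succ n ih =>
      rw [ih, step _ (by positivity) (pow_lt_one₀ h0.le h1 (by positivity)), ← pow_mul, ← pow_succ]
  have hlim : Tendsto (fun n : ℕ => q ^ 2 ^ n) atTop (𝓝[>] 0) := by
    refine tendsto_nhdsWithin_iff.2 ⟨?_, Eventually.of_forall fun n => pow_pos h0 _⟩
    exact (tendsto_pow_atTop_nhds_zero_of_lt_one h0.le h1).comp
      (tendsto_pow_atTop_atTop_of_one_lt one_lt_two)
  have hl := ((tendsto_twoSquareLambert.div (tendsto_squareSeries.pow 2) (by norm_num)).comp hlim)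
  have hc : Tendsto (fun _ : ℕ => twoSquareLambert q / squareSeries q ^ 2) atTop
      (𝓝 (1 / 2 / 1 ^ 2)) := hl.congr fun n => (iter n).symm
  have := tendsto_nhds_unique hc tendsto_const_nhds
  have hpos := pow_pos (squareSeries_pos h0 h1) 2
  rw [eq_comm, div_eq_iff hpos.ne'] at this
  linarith

/-! ### Sums of four squares -/

/-- Expand x/(1+x)² = -∑ k(-x)^k at x = pⁿ and exchange the two summations. -/
theorem tsum_pow_div_one_add_pow_sq {p : ℝ} (h0 : 0 < p) (h1 : p < 1) :
    ∑' n : ℕ+, p ^ (n : ℕ) / (1 + p ^ (n : ℕ)) ^ 2 =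
      -∑' k : ℕ+, (k : ℝ) * (-1) ^ (k : ℕ) * (p ^ (k : ℕ) / (1 - p ^ (k : ℕ))) := by
  have hs : Summable fun c : ℕ+ × ℕ+ =>
      ((c.2 : ℕ) : ℝ) * (-1) ^ (c.2 : ℕ) * p ^ ((c.1 : ℕ) * (c.2 : ℕ)) := by
    have h := (summable_prod_mul_pow (𝕜 := ℝ) 1 (r := p) (by rwa [Real.norm_of_nonneg h0.le])).norm
    refine Summable.of_norm (h.congr fun c => ?_)
    simp
  have hlt : ∀ n : ℕ+, p ^ (n : ℕ) < 1 := fun n => pow_lt_one₀ h0.le h1 n.ne_zero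
  have h2 : ∀ n : ℕ+, p ^ (n : ℕ) / (1 + p ^ (n : ℕ)) ^ 2 =
      -∑' k : ℕ+, ((k : ℕ) : ℝ) * (-1) ^ (k : ℕ) * p ^ ((n : ℕ) * (k : ℕ)) := by
    intro n
    have hn : ‖-p ^ (n : ℕ)‖ < 1 := by
      rw [norm_neg, Real.norm_of_nonneg (by positivity)]
      exact hlt n
    have h3 := tsum_coe_mul_geometric_of_norm_lt_one hn
    rw [← tsum_pnat_eq_tsum_of_eq_zero (f := fun k : ℕ => (k : ℝ) * (-p ^ (n : ℕ)) ^ k)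
      (by simp)] at h3
    have h4 : ∀ k : ℕ+, ((k : ℕ) : ℝ) * (-1) ^ (k : ℕ) * p ^ ((n : ℕ) * (k : ℕ)) =
        (k : ℕ) * (-p ^ (n : ℕ)) ^ (k : ℕ) := by
      intro k
      rw [neg_pow (p ^ (n : ℕ)), pow_mul]
      ring
    simp only [h4, h3, sub_neg_eq_add]
    ring
  have h5 : ∀ k : ℕ+, (k : ℝ) * (-1) ^ (k : ℕ) * (p ^ (k : ℕ) / (1 - p ^ (k : ℕ))) =
      ∑' n : ℕ+, ((k : ℕ) : ℝ) * (-1) ^ (k : ℕ) * p ^ ((n : ℕ) * (k : ℕ)) := by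
    intro k
    have hk : ‖p ^ (k : ℕ)‖ < 1 := by
      rw [Real.norm_of_nonneg (by positivity)]
      exact hlt k
    rw [tsum_mul_left, tsum_pnat_eq_tsum_succ (f := fun n : ℕ => p ^ (n * (k : ℕ)))]
    have h6 : ∀ n : ℕ, p ^ ((n + 1) * (k : ℕ)) = p ^ (k : ℕ) * (p ^ (k : ℕ)) ^ n := by
      intro n
      rw [← pow_succ', ← pow_mul, mul_comm]
    simp only [h6]
    rw [tsum_mul_left, tsum_geometric_of_norm_lt_one hk, div_eq_mul_inv]
  simp only [h2, h5]
  rw [tsum_neg]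
  congr 1
  exact Summable.tsum_comm (f := fun k n : ℕ+ =>
    ((k : ℕ) : ℝ) * (-1) ^ (k : ℕ) * p ^ ((n : ℕ) * (k : ℕ)))
    ((Equiv.prodComm ℕ+ ℕ+).summable_iff.2 hs)

/-- Jacobi's four square theorem, in terms of generating functions. -/
theorem squareSeries_pow_four {q : ℝ} (h0 : 0 < q) (h1 : q < 1) :
    squareSeries q ^ 4 =
      1 + 8 * ∑' k : ℕ+, q ^ (k : ℕ) * (k : ℝ) / (1 + (-q) ^ (k : ℕ)) := by
  have hp0 : q ^ 2 ≠ 0 := by positivity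
  have hpq : ‖q ^ 2‖ < ‖q‖ := by
    rw [Real.norm_of_nonneg (by positivity), Real.norm_of_nonneg h0.le]
    nlinarith
  have hq1 : ‖q‖ < 1 := by rwa [Real.norm_of_nonneg h0.le]
  have hp1 := hpq.trans hq1
  have hp1' : q ^ 2 < 1 := by nlinarith
  -- At p = q² and z = q the bilateral series being squared is `twoSquareLambert q`, that is
  -- □(q)²/2.
  have hA := hasSum_sq_tsum_plusCoeff hp0 hpq hq1
  have e1 : ∑' n : ℤ, plusCoeff (q ^ 2) n * plusCoeff (q ^ 2) (-n) =
      1 / 4 + 2 * ∑' n : ℕ+, (q ^ 2) ^ (n : ℕ) / (1 + (q ^ 2) ^ (n : ℕ)) ^ 2 := by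
    have hev : Function.Even fun n : ℤ => plusCoeff (q ^ 2) n * plusCoeff (q ^ 2) (-n) :=
      fun n => by simp only [neg_neg, mul_comm]
    rw [tsum_int_eq_zero_add_two_mul_tsum_pnat hev (summable_plusCoeff_mul_neg hp0 hp1),
      nsmul_eq_mul, Nat.cast_ofNat]
    congr 1
    · simp [plusCoeff]
      norm_num
    · congr 2
      funext n
      rw [plusCoeff_neg_eq_mul hp0 hp1]
      simp only [plusCoeff, zpow_natCast]
      rw [div_eq_mul_inv, ← inv_pow]
      ring
  have e2 : ∑' N : ℤ, q ^ N * (N * minusCoeff (q ^ 2) N) =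
      2 * ∑' n : ℕ+, (n : ℝ) * (q ^ (n : ℕ) / (1 - (q ^ 2) ^ (n : ℕ))) := by
    have hev : Function.Even fun N : ℤ => q ^ N * (N * minusCoeff (q ^ 2) N) := by
      intro n
      have h2 : (q ^ 2) ^ n = q ^ n * q ^ n := by
        rw [← zpow_natCast, ← zpow_mul, ← zpow_add₀ h0.ne']
        congr 1
        push_cast
        ring
      have h3 := zpow_ne_zero n h0.ne'
      simp only [minusCoeff_neg_eq_mul hp0 hp1, h2, zpow_neg, Int.cast_neg]
      field_simp
    rw [tsum_int_eq_zero_add_two_mul_tsum_pnat hev hA.summable, nsmul_eq_mul,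
      Nat.cast_ofNat]
    simp only [Int.cast_zero, zero_mul, mul_zero, zero_add]
    congr 2
    funext n
    simp only [minusCoeff, zpow_natCast, Int.cast_natCast]
    ring
  have e3 := hA.tsum_eq
  have e4 := squareSeries_sq h0 h1
  unfold twoSquareLambert at e4
  have e5 : squareSeries q ^ 4 = (squareSeries q ^ 2) ^ 2 := by ring
  rw [e5, e4, mul_pow]
  rw [e1, e2, tsum_pow_div_one_add_pow_sq (by positivity) hp1'] at e3
  have hs1 : Summable fun n : ℕ+ => (n : ℝ) * (q ^ (n : ℕ) / (1 - (q ^ 2) ^ (n : ℕ))) := by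
    have := (hA.summable.comp_injective (i := fun n : ℕ+ => ((n : ℕ) : ℤ)) (fun a b h => by
      simpa using h))
    refine this.congr fun n => ?_
    simp only [Function.comp, minusCoeff, zpow_natCast, Int.cast_natCast]
    ring
  have hsl := (lambert_summable h0 h1 1).1
  simp only [pow_one] at hsl
  -- With x = q^k, the right side is k x(1 ∓ x)/(1 - x²) for k even or odd; this is where the sign
  -- of (-q)^k comes from.
  have hterm : ∀ k : ℕ+, q ^ (k : ℕ) * (k : ℝ) / (1 + (-q) ^ (k : ℕ)) =
      (k : ℝ) * (q ^ (k : ℕ) / (1 - (q ^ 2) ^ (k : ℕ))) -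
      (k : ℝ) * (-1) ^ (k : ℕ) * ((q ^ 2) ^ (k : ℕ) / (1 - (q ^ 2) ^ (k : ℕ))) := by
    intro k
    have hk := pow_lt_one₀ h0.le h1 k.ne_zero
    have hk0 : 0 < q ^ (k : ℕ) := pow_pos h0 _
    have h2 : (q ^ 2) ^ (k : ℕ) = (q ^ (k : ℕ)) ^ 2 := by rw [← pow_mul, ← pow_mul, mul_comm]
    rw [h2, neg_pow]
    generalize q ^ (k : ℕ) = x at *
    have hx1 : 1 - x ^ 2 ≠ 0 := by nlinarith
    have hx2 : 1 - x ≠ 0 := by linarith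
    have hx3 : 1 + x ≠ 0 := by linarith
    rcases neg_one_pow_eq_or ℝ (k : ℕ) with h | h
    · rw [h, one_mul]
      field_simp
      ring
    · rw [h, neg_one_mul, ← sub_eq_add_neg]
      field_simp
      ring
  have hs2 : Summable fun k : ℕ+ => (k : ℝ) * (-1) ^ (k : ℕ) *
      ((q ^ 2) ^ (k : ℕ) / (1 - (q ^ 2) ^ (k : ℕ))) := by
    refine (hs1.sub hsl).congr fun k => ?_
    rw [hterm]
    ring
  simp only [hterm]
  rw [hs1.tsum_sub hs2]
  linarith

/-! ### Boundary values of the Laurent series on the unit circle -/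

theorem hasSum_sq_mul_geometric {z : ℂ} (hz : ‖z‖ < 1) :
    HasSum (fun n : ℕ => (n : ℂ) ^ 2 * z ^ n) (z * (1 + z) / (1 - z) ^ 3) := by
  have h2 := hasSum_choose_mul_geometric_of_norm_lt_one 2 hz
  have h1 := hasSum_coe_mul_geometric_of_norm_lt_one hz
  have h0 := hasSum_geometric_of_norm_lt_one hz
  have hz1 : 1 - z ≠ 0 := by
    intro h
    have : z = 1 := by linear_combination -h
    rw [this, norm_one] at hz
    exact lt_irrefl _ hz
  refine (((h2.mul_left 2).sub (h1.mul_left 3)).sub (h0.mul_left 2)).of_eq (fun n => ?_) ?_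
  · have hc : (((n + 2).choose 2 : ℕ) : ℂ) = (n + 2) * (n + 1) / 2 := by
      rw [Nat.cast_choose_two]
      push_cast
      ring
    rw [hc]
    ring
  · field_simp
    ring

/-- The sums `∑ k ^ j * z ^ k` over `k ≥ 1`, for `j = 0, 1, 2`. -/
noncomputable def geomMoment (j : ℕ) (z : ℂ) : ℂ :=
  if j = 0 then z / (1 - z) else if j = 1 then z / (1 - z) ^ 2 else z * (1 + z) / (1 - z) ^ 3

theorem hasSum_geomMoment {j : ℕ} (hj : j ≤ 2) {z : ℂ} (hz : ‖z‖ < 1) :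
    HasSum (fun k : ℕ+ => (k : ℂ) ^ j * z ^ (k : ℕ)) (geomMoment j z) := by
  have hz1 : 1 - z ≠ 0 := by
    intro h
    have : z = 1 := by linear_combination -h
    rw [this, norm_one] at hz
    exact lt_irrefl _ hz
  rw [hasSum_pnat_iff (f := fun n : ℕ => (n : ℂ) ^ j * z ^ n)]
  interval_cases j
  · refine (hasSum_geometric_of_norm_lt_one hz).of_eq (fun n => by simp) ?_
    simp [geomMoment]
    field_simp
    ring
  · refine (hasSum_coe_mul_geometric_of_norm_lt_one hz).of_eq (fun n => by simp) ?_
    simp [geomMoment]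
  · refine (hasSum_sq_mul_geometric hz).of_eq (fun n => by simp) ?_
    simp [geomMoment]

theorem continuousAt_geomMoment (j : ℕ) {z : ℂ} (hz : z ≠ 1) :
    ContinuousAt (geomMoment j) z := by
  have h : 1 - z ≠ 0 := sub_ne_zero.2 hz.symm
  unfold geomMoment
  split_ifs
  · exact continuousAt_id.div (by fun_prop) h
  · exact continuousAt_id.div (by fun_prop) (pow_ne_zero 2 h)
  · exact ContinuousAt.div (by fun_prop) (by fun_prop) (pow_ne_zero 3 h)

/-- The part of a Laurent series that converges on both sides of the unit circle. -/
noncomputable def laurentTail (b : ℕ+ → ℂ) (j : ℕ) (z : ℂ) : ℂ :=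
  ∑' k : ℕ+, (k : ℂ) ^ j * b k * (z ^ (k : ℕ) - (-1) ^ j * (z⁻¹) ^ (k : ℕ))

theorem summable_pnat_pow_mul_pow {r : ℝ} (h0 : 0 ≤ r) (h1 : r < 1) (j : ℕ) :
    Summable fun k : ℕ+ => (k : ℝ) ^ j * r ^ (k : ℕ) :=
  (summable_pow_mul_geometric_of_norm_lt_one j (r := r)
    (by rwa [Real.norm_of_nonneg h0])).comp_injective PNat.coe_injective

theorem norm_laurentTail_term_le {b : ℕ+ → ℂ} {C r ρ : ℝ} (hρ0 : 0 < ρ)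
    (hb : ∀ k, ‖b k‖ ≤ C * r ^ (k : ℕ)) (j : ℕ) {z : ℂ} (hz : ρ ≤ ‖z‖) (hz1 : ‖z‖ ≤ 1)
    (k : ℕ+) :
    ‖(k : ℂ) ^ j * b k * (z ^ (k : ℕ) - (-1) ^ j * (z⁻¹) ^ (k : ℕ))‖ ≤
      2 * C * ((k : ℝ) ^ j * (r / ρ) ^ (k : ℕ)) := by
  have hρ1 := hz.trans hz1
  have hi : ‖z⁻¹‖ ≤ ρ⁻¹ := by
    rw [norm_inv]
    exact inv_anti₀ hρ0 hz
  have hone : 1 ≤ ρ⁻¹ := (one_le_inv₀ hρ0).2 hρ1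
  have h1 : ‖z ^ (k : ℕ) - (-1) ^ j * (z⁻¹) ^ (k : ℕ)‖ ≤ 2 * (ρ⁻¹) ^ (k : ℕ) := by
    refine (norm_sub_le _ _).trans ?_
    rw [norm_mul, norm_pow, norm_pow, norm_pow, norm_neg, norm_one, one_pow, one_mul]
    have h2 := pow_le_pow_left₀ (norm_nonneg _) hi k
    have h3 := pow_le_pow_left₀ (norm_nonneg _) (hz1.trans hone) k
    linarith
  rw [norm_mul, norm_mul, norm_pow]
  have hk : ‖((k : ℕ) : ℂ)‖ = (k : ℕ) := RCLike.norm_natCast _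
  rw [hk]
  calc (k : ℝ) ^ j * ‖b k‖ * ‖z ^ (k : ℕ) - (-1) ^ j * (z⁻¹) ^ (k : ℕ)‖
      ≤ (k : ℝ) ^ j * (C * r ^ (k : ℕ)) * (2 * (ρ⁻¹) ^ (k : ℕ)) := by
        have := hb k
        have := (norm_nonneg _).trans this
        gcongr
    _ = _ := by
        rw [div_pow, inv_pow]
        ring

theorem summable_laurentTail {b : ℕ+ → ℂ} {C r : ℝ} (hr0 : 0 ≤ r)
    (hb : ∀ k, ‖b k‖ ≤ C * r ^ (k : ℕ)) (j : ℕ) {z : ℂ} (hz : r < ‖z‖) (hz1 : ‖z‖ ≤ 1) :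
    Summable fun k : ℕ+ => (k : ℂ) ^ j * b k * (z ^ (k : ℕ) - (-1) ^ j * (z⁻¹) ^ (k : ℕ)) := by
  have hz0 := hr0.trans_lt hz
  exact Summable.of_norm_bounded ((summable_pnat_pow_mul_pow (div_nonneg hr0 hz0.le)
    ((div_lt_one hz0).2 hz) j).mul_left (2 * C)) fun k =>
      norm_laurentTail_term_le hz0 hb j le_rfl hz1 k

theorem tendsto_laurentTail {b : ℕ+ → ℂ} {C r : ℝ} (hr0 : 0 ≤ r) (hr1 : r < 1)
    (hb : ∀ k, ‖b k‖ ≤ C * r ^ (k : ℕ)) (j : ℕ) {z : ℂ} (hz : ‖z‖ = 1) :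
    Tendsto (fun t : ℝ => laurentTail b j (t * z)) (𝓝[<] 1) (𝓝 (laurentTail b j z)) := by
  have hz0 : z ≠ 0 := by
    rintro rfl
    simp at hz
  -- Any radius strictly between r and 1 serves: for ρ < t < 1 all terms have a common summable
  -- bound.
  set ρ := (r + 1) / 2 with hρ
  have hρ0 : 0 < ρ := by linarith
  have hρr : r < ρ := by linarith
  unfold laurentTail
  refine tendsto_tsum_of_dominated_convergence
    ((summable_pnat_pow_mul_pow (div_nonneg hr0 hρ0.le) ((div_lt_one hρ0).2 hρr) j).mul_left
      (2 * C)) (fun k => ?_) ?_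
  · have hc : ContinuousAt (fun t : ℝ => (k : ℂ) ^ j * b k *
        ((t * z) ^ (k : ℕ) - (-1) ^ j * ((t * z)⁻¹) ^ (k : ℕ))) 1 := by
      have h1 : ContinuousAt (fun t : ℝ => (t * z : ℂ)) 1 := by fun_prop
      have h2 : ContinuousAt (fun t : ℝ => (t * z : ℂ)⁻¹) 1 := h1.inv₀ (by simpa using hz0)
      exact continuousAt_const.mul ((h1.pow _).sub (continuousAt_const.mul (h2.pow _)))
    have := hc.tendsto.mono_left (nhdsWithin_le_nhds (s := Set.Iio 1))
    simpa using this
  · have hev : ∀ᶠ t : ℝ in 𝓝[<] 1, ρ < t ∧ t < 1 := Ioo_mem_nhdsLT (by linarith)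
    filter_upwards [hev] with t ht k
    have hn : ‖(t * z : ℂ)‖ = t := by
      rw [norm_mul, hz, mul_one, Complex.norm_real, Real.norm_of_nonneg (by linarith [ht.1])]
    exact norm_laurentTail_term_le hρ0 hb j (by rw [hn]; exact ht.1.le)
      (by rw [hn]; exact ht.2.le) k

/-- For positive n, write a n = 1 - a (-n). The 1 sums to a rational function with its pole at z =
1; what remains decays geometrically and continues across the unit circle. -/
theorem tsum_laurent_eq {p z : ℂ} (hp0 : p ≠ 0) (hpz : ‖p‖ < ‖z‖) (hz : ‖z‖ < 1)
    {a : ℤ → ℂ} {C : ℝ} (h1 : ∀ n : ℕ, ‖a n‖ ≤ C) (h2 : ∀ n : ℕ, ‖a (-n)‖ ≤ C * ‖p‖ ^ n)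
    (h3 : ∀ n : ℕ+, a (n : ℕ) = 1 - a (-(n : ℕ))) {j : ℕ} (hj : j ≤ 2) :
    ∑' n : ℤ, z ^ n * ((n : ℂ) ^ j * a n) = 0 ^ j * a 0 + geomMoment j z -
      laurentTail (fun k => a (-(k : ℕ))) j z := by
  have hs := (summable_norm_laurent hp0 hpz hz h1 h2 j).of_norm
  have hg := hasSum_geomMoment hj hz
  have ht := summable_laurentTail (norm_nonneg p) (fun k : ℕ+ => h2 k) j hpz hz.le
  have hsn : Summable fun n : ℕ+ => z ^ (-((n : ℕ) : ℤ)) *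
      (((-((n : ℕ) : ℤ) : ℤ) : ℂ) ^ j * a (-(n : ℕ))) :=
    hs.comp_injective (i := fun n : ℕ+ => -((n : ℕ) : ℤ)) (fun a b h => by simpa using h)
  rw [tsum_int_eq_zero_add_tsum_pnat hs, laurentTail, ← hg.tsum_eq]
  rw [zpow_zero, one_mul, Int.cast_zero, add_sub_assoc, ← hg.summable.tsum_sub ht, add_assoc]
  congr 1
  rw [← eq_sub_iff_add_eq, ← (hg.summable.sub ht).tsum_sub hsn]
  congr 1
  funext k
  rw [h3, zpow_neg, zpow_natCast, Int.cast_neg, Int.cast_natCast, inv_pow, neg_pow (k : ℂ)]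
  ring

/-- The continuation of `∑ n ^ j * z ^ n / (1 + p ^ n)` to the unit circle. -/
noncomputable def plusBoundary (p : ℂ) (j : ℕ) (z : ℂ) : ℂ :=
  0 ^ j * (1 / 2) + geomMoment j z - laurentTail (fun k => plusCoeff p (-(k : ℕ))) j z

/-- The continuation of `∑ n * z ^ n / (1 - p ^ n)` to the unit circle. -/
noncomputable def minusBoundary (p z : ℂ) : ℂ :=
  geomMoment 1 z - laurentTail (fun k => minusCoeff p (-(k : ℕ))) 1 z

theorem tsum_plusCoeff_eq_plusBoundary {p z : ℂ} (hp0 : p ≠ 0) (hpz : ‖p‖ < ‖z‖) (hz : ‖z‖ < 1)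
    {j : ℕ} (hj : j ≤ 2) :
    ∑' n : ℤ, z ^ n * ((n : ℂ) ^ j * plusCoeff p n) = plusBoundary p j z := by
  have hp1 := hpz.trans hz
  rw [tsum_laurent_eq hp0 hpz hz (norm_plusCoeff_natCast_le hp1)
    (norm_plusCoeff_neg_natCast_le hp0 hp1)
    (fun n => by rw [plusCoeff_neg hp0 hp1]; ring) hj, plusBoundary]
  congr 3
  simp [plusCoeff]
  norm_num

theorem tsum_minusCoeff_eq_minusBoundary {p z : ℂ} (hp0 : p ≠ 0) (hpz : ‖p‖ < ‖z‖)
    (hz : ‖z‖ < 1) :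
    ∑' n : ℤ, z ^ n * (n * minusCoeff p n) = minusBoundary p z := by
  have hp1 := hpz.trans hz
  have := tsum_laurent_eq hp0 hpz hz (norm_minusCoeff_natCast_le hp1)
    (norm_minusCoeff_neg_natCast_le hp0 hp1)
    (fun n => by
      rw [minusCoeff_neg hp0 hp1 (by exact_mod_cast n.ne_zero)]; ring) (j := 1) (by norm_num)
  simpa [minusBoundary] using this

theorem tendsto_geomMoment (j : ℕ) {z : ℂ} (hz : z ≠ 1) :
    Tendsto (fun t : ℝ => geomMoment j (t * z)) (𝓝[<] 1) (𝓝 (geomMoment j z)) := by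
  have h1 : Tendsto (fun t : ℝ => (t * z : ℂ)) (𝓝[<] 1) (𝓝 z) := by
    have : ContinuousAt (fun t : ℝ => (t * z : ℂ)) 1 := by fun_prop
    simpa using this.tendsto.mono_left (nhdsWithin_le_nhds (s := Set.Iio 1))
  exact (continuousAt_geomMoment j hz).tendsto.comp h1

theorem tendsto_plusBoundary {p z : ℂ} (hp0 : p ≠ 0) (hp1 : ‖p‖ < 1) (hz : ‖z‖ = 1)
    (hz1 : z ≠ 1) (j : ℕ) :
    Tendsto (fun t : ℝ => plusBoundary p j (t * z)) (𝓝[<] 1) (𝓝 (plusBoundary p j z)) :=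
  (tendsto_const_nhds.add (tendsto_geomMoment j hz1)).sub
    (tendsto_laurentTail (norm_nonneg p) hp1
      (fun k : ℕ+ => norm_plusCoeff_neg_natCast_le hp0 hp1 k) j hz)

theorem tendsto_minusBoundary {p z : ℂ} (hp0 : p ≠ 0) (hp1 : ‖p‖ < 1) (hz : ‖z‖ = 1)
    (hz1 : z ≠ 1) :
    Tendsto (fun t : ℝ => minusBoundary p (t * z)) (𝓝[<] 1) (𝓝 (minusBoundary p z)) :=
  (tendsto_geomMoment 1 hz1).sub
    (tendsto_laurentTail (norm_nonneg p) hp1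
      (fun k : ℕ+ => norm_minusCoeff_neg_natCast_le hp0 hp1 k) 1 hz)

/-- Both identities hold in the annulus, and both sides have radial limits at each z ≠ 1 on the unit
circle. -/
theorem exists_boundary_identities {p : ℂ} (hp0 : p ≠ 0) (hp1 : ‖p‖ < 1) :
    ∃ κ T : ℂ, ∀ z : ℂ, ‖z‖ = 1 → z ≠ 1 →
      plusBoundary p 0 z ^ 2 - κ = minusBoundary p z ∧
      plusBoundary p 0 z * minusBoundary p z =
        T * plusBoundary p 0 z + 1 / 2 * plusBoundary p 2 z := by
  obtain ⟨T, hT⟩ := exists_hasSum_tsum_plusCoeff_mul hp0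
  refine ⟨∑' n : ℤ, plusCoeff p n * plusCoeff p (-n), T, fun z hz hz1 => ?_⟩
  have hev : ∀ᶠ t : ℝ in 𝓝[<] 1, ‖p‖ < ‖(t * z : ℂ)‖ ∧ ‖(t * z : ℂ)‖ < 1 := by
    have h : ∀ᶠ t : ℝ in 𝓝[<] 1, ‖p‖ < t ∧ t < 1 := Ioo_mem_nhdsLT hp1
    filter_upwards [h] with t ht
    rw [norm_mul, hz, mul_one, Complex.norm_real,
      Real.norm_of_nonneg ((norm_nonneg p).trans ht.1.le)]
    exact ht
  have hK := tendsto_plusBoundary hp0 hp1 hz hz1 0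
  have hL := tendsto_minusBoundary hp0 hp1 hz hz1
  have hM := tendsto_plusBoundary hp0 hp1 hz hz1 2
  have hK0 : ∀ w : ℂ, ‖p‖ < ‖w‖ → ‖w‖ < 1 →
      ∑' n : ℤ, w ^ n * plusCoeff p n = plusBoundary p 0 w := by
    intro w h1 h2
    simpa using tsum_plusCoeff_eq_plusBoundary hp0 h1 h2 (j := 0) (by norm_num)
  constructor
  · refine tendsto_nhds_unique (((hK.pow 2).sub_const _).congr' ?_) hL
    filter_upwards [hev] with t ht
    rw [← tsum_minusCoeff_eq_minusBoundary hp0 ht.1 ht.2, ← hK0 _ ht.1 ht.2,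
      (hasSum_sq_tsum_plusCoeff hp0 ht.1 ht.2).tsum_eq]
  · refine tendsto_nhds_unique ((hK.mul hL).congr' ?_) ((hK.const_mul T).add (hM.const_mul (1 / 2)))
    filter_upwards [hev] with t ht
    rw [← tsum_minusCoeff_eq_minusBoundary hp0 ht.1 ht.2, ← hK0 _ ht.1 ht.2,
      ← tsum_plusCoeff_eq_plusBoundary hp0 ht.1 ht.2 (j := 2) le_rfl]
    exact hT _ ht.1 ht.2

/-! ### Real trigonometric series -/

/-- The sine series with coefficients `c k`, `k ≥ 1`. -/
noncomputable def sinSeries (c : ℕ+ → ℝ) (x : ℝ) : ℝ := ∑' k : ℕ+, c k * Real.sin (k * x)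

/-- The cosine series with coefficients `c k`, `k ≥ 1`. -/
noncomputable def cosSeries (c : ℕ+ → ℝ) (x : ℝ) : ℝ := ∑' k : ℕ+, c k * Real.cos (k * x)

/-- The coefficients `q ^ k * k ^ r / (1 + (-q) ^ k)`. -/
noncomputable def plusLambert (q : ℝ) (r : ℕ) (k : ℕ+) : ℝ :=
  q ^ (k : ℕ) * (k : ℝ) ^ r / (1 + (-q) ^ (k : ℕ))

/-- The coefficients `q ^ k * k ^ r / (1 - (-q) ^ k)`. -/
noncomputable def minusLambert (q : ℝ) (r : ℕ) (k : ℕ+) : ℝ :=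
  q ^ (k : ℕ) * (k : ℝ) ^ r / (1 - (-q) ^ (k : ℕ))

theorem boundary_pow (x : ℝ) (k : ℕ) :
    (-Complex.exp (x * Complex.I)) ^ k =
      (-1) ^ k * (Complex.cos (k * x) + Complex.sin (k * x) * Complex.I) := by
  rw [neg_pow, ← Complex.exp_nat_mul, ← Complex.exp_mul_I]
  ring_nf

theorem boundary_inv_pow (x : ℝ) (k : ℕ) :
    ((-Complex.exp (x * Complex.I))⁻¹) ^ k =
      (-1) ^ k * (Complex.cos (k * x) - Complex.sin (k * x) * Complex.I) := by
  have h : (-Complex.exp (x * Complex.I))⁻¹ = -Complex.exp ((-x : ℝ) * Complex.I) := by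
    rw [inv_neg, ← Complex.exp_neg]
    push_cast
    ring_nf
  rw [h, boundary_pow]
  push_cast
  rw [mul_neg, Complex.cos_neg, Complex.sin_neg]
  ring

/-- The signs in p = -q and z = -exp(ix) cancel to give q^k in the numerator, and even j leaves z^k
- z^(-k), a sine. -/
theorem laurentTail_plusCoeff {q : ℝ} (h0 : 0 < q) (h1 : q < 1) {j : ℕ} (hj : Even j) (x : ℝ) :
    laurentTail (fun k => plusCoeff ((-q : ℝ) : ℂ) (-(k : ℕ))) j (-Complex.exp (x * Complex.I)) =
      2 * Complex.I * (sinSeries (plusLambert q j) x : ℝ) := by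
  have hp0 : ((-q : ℝ) : ℂ) ≠ 0 := by exact_mod_cast (neg_ne_zero.2 h0.ne')
  have hp1 : ‖((-q : ℝ) : ℂ)‖ < 1 := by
    rwa [Complex.norm_real, norm_neg, Real.norm_of_nonneg h0.le]
  unfold laurentTail sinSeries
  rw [Complex.ofReal_tsum, ← tsum_mul_left]
  congr 1
  funext k
  simp only [plusCoeff_neg_eq_mul hp0 hp1]
  rw [boundary_pow, boundary_inv_pow, hj.neg_one_pow]
  unfold plusCoeff plusLambert
  push_cast
  rw [zpow_natCast]
  have h2 : (-(q : ℂ)) ^ (k : ℕ) * (-1) ^ (k : ℕ) = (q : ℂ) ^ (k : ℕ) := by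
    rw [← mul_pow]
    ring_nf
  rw [← h2]
  ring

theorem laurentTail_minusCoeff {q : ℝ} (h0 : 0 < q) (h1 : q < 1) (x : ℝ) :
    laurentTail (fun k => minusCoeff ((-q : ℝ) : ℂ) (-(k : ℕ))) 1
        (-Complex.exp (x * Complex.I)) =
      -(2 * (cosSeries (minusLambert q 1) x : ℝ)) := by
  have hp0 : ((-q : ℝ) : ℂ) ≠ 0 := by exact_mod_cast (neg_ne_zero.2 h0.ne')
  have hp1 : ‖((-q : ℝ) : ℂ)‖ < 1 := by
    rwa [Complex.norm_real, norm_neg, Real.norm_of_nonneg h0.le]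
  unfold laurentTail cosSeries
  rw [Complex.ofReal_tsum, ← tsum_mul_left, ← tsum_neg]
  congr 1
  funext k
  simp only [minusCoeff_neg_eq_mul hp0 hp1]
  rw [boundary_pow, boundary_inv_pow]
  unfold minusCoeff minusLambert
  push_cast
  rw [zpow_natCast]
  have h2 : (-(q : ℂ)) ^ (k : ℕ) * (-1) ^ (k : ℕ) = (q : ℂ) ^ (k : ℕ) := by
    rw [← mul_pow]
    ring_nf
  rw [← h2]
  ring

/-- With u = exp(ix/2), the boundary values and the trigonometric functions all become rational in
u, so that they can be compared algebraically. -/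
theorem exists_half_angle {x : ℝ} (hx : Real.cos (x / 2) ≠ 0) :
    ∃ u : ℂ, u ≠ 0 ∧ u ^ 2 + 1 ≠ 0 ∧ -Complex.exp (x * Complex.I) = -u ^ 2 ∧
      ((Real.cos (x / 2) : ℝ) : ℂ) = (u ^ 2 + 1) / (2 * u) ∧
      ((Real.sin (x / 2) : ℝ) : ℂ) = -Complex.I * (u ^ 2 - 1) / (2 * u) := by
  have hu : Complex.exp ((x / 2 : ℝ) * Complex.I) ≠ 0 := Complex.exp_ne_zero _
  have hc : ((Real.cos (x / 2) : ℝ) : ℂ) =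
      (Complex.exp ((x / 2 : ℝ) * Complex.I) ^ 2 + 1) /
        (2 * Complex.exp ((x / 2 : ℝ) * Complex.I)) := by
    rw [Complex.ofReal_cos, Complex.cos, neg_mul, Complex.exp_neg]
    field_simp
  have hs : ((Real.sin (x / 2) : ℝ) : ℂ) =
      -Complex.I * (Complex.exp ((x / 2 : ℝ) * Complex.I) ^ 2 - 1) /
        (2 * Complex.exp ((x / 2 : ℝ) * Complex.I)) := by
    rw [Complex.ofReal_sin, Complex.sin, neg_mul, Complex.exp_neg]
    field_simp
    ring
  refine ⟨_, hu, fun h => hx ?_, ?_, hc, hs⟩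
  · rw [h, zero_div] at hc
    exact_mod_cast hc
  · rw [← Complex.exp_nat_mul]
    push_cast
    ring_nf

/-- The function `tan (x / 2) + 4 * ∑ q ^ k * sin (k * x) / (1 + (-q) ^ k)`. -/
noncomputable def plusTan (q x : ℝ) : ℝ := Real.tan (x / 2) + 4 * sinSeries (plusLambert q 0) x

/-- The function `tan (x / 2) - 4 * ∑ q ^ k * sin (k * x) / (1 - (-q) ^ k)`. -/
noncomputable def minusTan (q x : ℝ) : ℝ :=
  Real.tan (x / 2) - 4 * sinSeries (minusLambert q 0) x

theorem plusTan_zero (q : ℝ) : plusTan q 0 = 0 := by simp [plusTan, sinSeries]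

theorem exists_trig_identities {q : ℝ} (h0 : 0 < q) (h1 : q < 1) :
    ∃ κ T : ℝ, ∀ x : ℝ, Real.cos (x / 2) ≠ 0 →
      plusTan q x ^ 2 =
        κ + 2 * (1 / (2 * Real.cos (x / 2) ^ 2) - 4 * cosSeries (minusLambert q 1) x) ∧
      Real.sin (x / 2) / (2 * Real.cos (x / 2) ^ 3) - 4 * sinSeries (plusLambert q 2) x =
        1 / 2 * plusTan q x ^ 3 + T * plusTan q x := by
  have hp0 : ((-q : ℝ) : ℂ) ≠ 0 := by exact_mod_cast (neg_ne_zero.2 h0.ne')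
  have hp1 : ‖((-q : ℝ) : ℂ)‖ < 1 := by
    rwa [Complex.norm_real, norm_neg, Real.norm_of_nonneg h0.le]
  obtain ⟨κ, T, H⟩ := exists_boundary_identities hp0 hp1
  -- With K = -(i/2) f, L = -g'/2 and M = (i/2) f'', the complex identities read f² - 2g' = -4κ and
  -- f'' = f g' + 2T f. Substituting the first into the second gives f'' = f³/2 + (2κ + 2T) f; real
  -- parts make the constants real.
  refine ⟨(-4 * κ).re, (2 * κ + 2 * T).re, fun x hx => ?_⟩
  obtain ⟨u, hu0, hu1, hz, hc, hs⟩ := exists_half_angle hx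
  have hcz : ((Real.cos (x / 2) : ℝ) : ℂ) ≠ 0 := by exact_mod_cast hx
  have hI := Complex.I_sq
  have hu2 : 1 - -u ^ 2 ≠ 0 := fun h => hu1 (by linear_combination h)
  have hz1 : -Complex.exp (x * Complex.I) ≠ 1 := by
    rw [hz]
    intro h
    exact hu1 (by linear_combination -h)
  have hzn : ‖-Complex.exp (x * Complex.I)‖ = 1 := by
    rw [norm_neg, Complex.norm_exp_ofReal_mul_I]
  obtain ⟨hA, hB⟩ := H _ hzn hz1
  have eK : plusBoundary ((-q : ℝ) : ℂ) 0 (-Complex.exp (x * Complex.I)) =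
      -(Complex.I / 2) * (plusTan q x : ℝ) := by
    rw [plusBoundary, laurentTail_plusCoeff h0 h1 Even.zero, hz, plusTan, Real.tan_eq_sin_div_cos]
    push_cast [geomMoment]
    rw [← Complex.ofReal_ofNat 2, ← Complex.ofReal_div, ← Complex.ofReal_sin,
      ← Complex.ofReal_cos, hc, hs]
    simp only [pow_zero, Complex.ofReal_ofNat]
    field_simp
    ring_nf
    simp only [hI]
    ring
  have eL : minusBoundary ((-q : ℝ) : ℂ) (-Complex.exp (x * Complex.I)) =
      -(1 / 2) * ((1 / (2 * Real.cos (x / 2) ^ 2) - 4 * cosSeries (minusLambert q 1) x : ℝ) : ℂ) := by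
    rw [minusBoundary, laurentTail_minusCoeff h0 h1, hz]
    rw [Complex.ofReal_sub, Complex.ofReal_div, Complex.ofReal_mul, Complex.ofReal_pow, hc]
    push_cast [geomMoment]
    field_simp
    ring
  have eM : plusBoundary ((-q : ℝ) : ℂ) 2 (-Complex.exp (x * Complex.I)) =
      Complex.I / 2 * ((Real.sin (x / 2) / (2 * Real.cos (x / 2) ^ 3) -
        4 * sinSeries (plusLambert q 2) x : ℝ) : ℂ) := by
    rw [plusBoundary, laurentTail_plusCoeff h0 h1 even_two, hz]
    rw [Complex.ofReal_sub, Complex.ofReal_div, Complex.ofReal_mul, Complex.ofReal_pow, hc, hs]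
    push_cast [geomMoment]
    simp only [two_ne_zero, ne_eq, not_false_eq_true, zero_pow]
    field_simp
    ring_nf
    simp only [hI]
    ring
  rw [eK, eL] at hA
  rw [eK, eL, eM] at hB
  generalize plusTan q x = f at *
  generalize 1 / (2 * Real.cos (x / 2) ^ 2) - 4 * cosSeries (minusLambert q 1) x = g at *
  generalize Real.sin (x / 2) / (2 * Real.cos (x / 2) ^ 3) -
    4 * sinSeries (plusLambert q 2) x = h at *
  have hA' : ((f ^ 2 - 2 * g : ℝ) : ℂ) = -4 * κ := by
    push_cast
    linear_combination -4 * hA + (f : ℂ) ^ 2 * hI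
  have hB' : ((h - 1 / 2 * f ^ 3 : ℝ) : ℂ) = (f : ℝ) * (2 * κ + 2 * T) := by
    push_cast at hA' ⊢
    have hB2 : (h : ℂ) = f * g + 2 * T * f := by
      linear_combination (4 * Complex.I) * hB + (h - f * g - 2 * T * f : ℂ) * hI
    linear_combination hB2 - 1 / 2 * (f : ℂ) * hA'
  have hA2 := congrArg Complex.re hA'
  have hB2 := congrArg Complex.re hB'
  rw [Complex.ofReal_re] at hA2
  rw [Complex.re_ofReal_mul, Complex.ofReal_re] at hB2
  constructor
  · linarith
  · linarith

/-! ### Derivatives of the trigonometric series -/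

theorem abs_sinSeries_term_le (c : ℕ+ → ℝ) (x : ℝ) (k : ℕ+) : ‖c k * Real.sin (k * x)‖ ≤ |c k| := by
  rw [norm_mul, Real.norm_eq_abs, Real.norm_eq_abs]
  exact mul_le_of_le_one_right (abs_nonneg _) (Real.abs_sin_le_one _)

theorem abs_cosSeries_term_le (c : ℕ+ → ℝ) (x : ℝ) (k : ℕ+) : ‖c k * Real.cos (k * x)‖ ≤ |c k| := by
  rw [norm_mul, Real.norm_eq_abs, Real.norm_eq_abs]
  exact mul_le_of_le_one_right (abs_nonneg _) (Real.abs_cos_le_one _)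

theorem hasDerivAt_sinSeries {c : ℕ+ → ℝ} (h0 : Summable c)
    (h1 : Summable fun k : ℕ+ => k * c k) (x : ℝ) :
    HasDerivAt (sinSeries c) (cosSeries (fun k => k * c k) x) x := by
  refine hasDerivAt_tsum (y₀ := 0) (u := fun k : ℕ+ => |k * c k|) h1.abs
    (g := fun (k : ℕ+) x => c k * Real.sin (k * x))
    (g' := fun (k : ℕ+) x => (k * c k) * Real.cos (k * x)) (fun k y => ?_)
    (fun k y => abs_cosSeries_term_le (fun k => k * c k) y k)
    (Summable.of_norm_bounded h0.abs fun k => abs_sinSeries_term_le c 0 k) x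
  have := (((hasDerivAt_id y).const_mul (k : ℝ)).sin).const_mul (c k)
  refine this.congr_deriv ?_
  simp
  ring

theorem hasDerivAt_cosSeries {c : ℕ+ → ℝ} (h0 : Summable c)
    (h1 : Summable fun k : ℕ+ => k * c k) (x : ℝ) :
    HasDerivAt (cosSeries c) (-sinSeries (fun k => k * c k) x) x := by
  unfold sinSeries
  rw [← tsum_neg]
  refine hasDerivAt_tsum (y₀ := 0) (u := fun k : ℕ+ => |k * c k|) h1.abs
    (g := fun (k : ℕ+) x => c k * Real.cos (k * x))
    (g' := fun (k : ℕ+) x => -((k * c k) * Real.sin (k * x))) (fun k y => ?_)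
    (fun k y => by
      rw [norm_neg]
      exact abs_sinSeries_term_le (fun k => k * c k) y k)
    (Summable.of_norm_bounded h0.abs fun k => abs_cosSeries_term_le c 0 k) x
  have := (((hasDerivAt_id y).const_mul (k : ℝ)).cos).const_mul (c k)
  refine this.congr_deriv ?_
  simp
  ring

/-- A sequence all of whose moments converge absolutely. -/
def RapidDecay (c : ℕ+ → ℝ) : Prop := ∀ r : ℕ, Summable fun k : ℕ+ => (k : ℝ) ^ r * c k

theorem RapidDecay.summable {c : ℕ+ → ℝ} (h : RapidDecay c) : Summable c := by
  simpa using h 0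

theorem RapidDecay.natCast_mul {c : ℕ+ → ℝ} (h : RapidDecay c) :
    RapidDecay fun k => k * c k := fun r =>
  (h (r + 1)).congr fun k => by ring

theorem RapidDecay.hasDerivAt_sinSeries {c : ℕ+ → ℝ} (h : RapidDecay c) (x : ℝ) :
    HasDerivAt (sinSeries c) (cosSeries (fun k => k * c k) x) x :=
  _root_.hasDerivAt_sinSeries h.summable h.natCast_mul.summable x

theorem RapidDecay.hasDerivAt_cosSeries {c : ℕ+ → ℝ} (h : RapidDecay c) (x : ℝ) :
    HasDerivAt (cosSeries c) (-sinSeries (fun k => k * c k) x) x :=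
  _root_.hasDerivAt_cosSeries h.summable h.natCast_mul.summable x

theorem RapidDecay.deriv_sinSeries {c : ℕ+ → ℝ} (h : RapidDecay c) :
    deriv (sinSeries c) = cosSeries (fun k => k * c k) :=
  funext fun x => (h.hasDerivAt_sinSeries x).deriv

theorem RapidDecay.deriv_cosSeries {c : ℕ+ → ℝ} (h : RapidDecay c) :
    deriv (cosSeries c) = -sinSeries (fun k => k * c k) :=
  funext fun x => (h.hasDerivAt_cosSeries x).deriv

theorem RapidDecay.contDiff_nat {c : ℕ+ → ℝ} (h : RapidDecay c) (n : ℕ) :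
    ContDiff ℝ n (sinSeries c) ∧ ContDiff ℝ n (cosSeries c) := by
  induction n generalizing c with
  | zero =>
    have hs : Differentiable ℝ (sinSeries c) := fun x => (h.hasDerivAt_sinSeries x).differentiableAt
    have hc : Differentiable ℝ (cosSeries c) := fun x => (h.hasDerivAt_cosSeries x).differentiableAt
    simpa [contDiff_zero] using And.intro hs.continuous hc.continuous
  | succ n ih =>
    have hs : Differentiable ℝ (sinSeries c) := fun x => (h.hasDerivAt_sinSeries x).differentiableAt
    have hc : Differentiable ℝ (cosSeries c) := fun x => (h.hasDerivAt_cosSeries x).differentiableAt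
    obtain ⟨i1, i2⟩ := ih h.natCast_mul
    push_cast
    constructor
    · refine contDiff_succ_iff_deriv.2 ⟨hs, fun h => absurd h (by simp), ?_⟩
      rwa [h.deriv_sinSeries]
    · refine contDiff_succ_iff_deriv.2 ⟨hc, fun h => absurd h (by simp), ?_⟩
      rw [h.deriv_cosSeries]
      exact i1.neg

theorem RapidDecay.contDiff_sinSeries {c : ℕ+ → ℝ} (h : RapidDecay c) (n : ℕ) :
    ContDiff ℝ n (sinSeries c) := (h.contDiff_nat n).1

theorem RapidDecay.iteratedDeriv_sinSeries_zero {c : ℕ+ → ℝ} (h : RapidDecay c) (n : ℕ) :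
    iteratedDeriv (2 * n + 1) (sinSeries c) 0 =
      (-1) ^ n * ∑' k : ℕ+, (k : ℝ) ^ (2 * n + 1) * c k := by
  induction n generalizing c with
  | zero => simp [iteratedDeriv_one, h.deriv_sinSeries, cosSeries]
  | succ n ih =>
    rw [show 2 * (n + 1) + 1 = 2 * n + 1 + 1 + 1 by ring, iteratedDeriv_succ', h.deriv_sinSeries,
      iteratedDeriv_succ', h.natCast_mul.deriv_cosSeries, iteratedDeriv_neg,
      ih h.natCast_mul.natCast_mul, pow_succ]
    rw [mul_neg_one, neg_mul]
    congr 3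
    funext k
    ring

theorem rapidDecay_plusLambert {q : ℝ} (h0 : 0 < q) (h1 : q < 1) (r : ℕ) :
    RapidDecay (plusLambert q r) := fun s =>
  (lambert_summable h0 h1 (r + s)).1.congr fun k => by
    unfold plusLambert
    rw [pow_add]
    ring

theorem rapidDecay_minusLambert {q : ℝ} (h0 : 0 < q) (h1 : q < 1) (r : ℕ) :
    RapidDecay (minusLambert q r) := fun s =>
  (lambert_summable h0 h1 (r + s)).2.congr fun k => by
    unfold minusLambert
    rw [pow_add]
    ring

theorem natCast_mul_plusLambert (q : ℝ) (r : ℕ) :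
    (fun k : ℕ+ => (k : ℝ) * plusLambert q r k) = plusLambert q (r + 1) := by
  funext k
  unfold plusLambert
  ring

theorem natCast_mul_minusLambert (q : ℝ) (r : ℕ) :
    (fun k : ℕ+ => (k : ℝ) * minusLambert q r k) = minusLambert q (r + 1) := by
  funext k
  unfold minusLambert
  ring

/-! ### Taylor series at zero -/

/-- The Taylor series of a function at `0`. -/
noncomputable def taylorZero (f : ℝ → ℝ) : PowerSeries ℝ :=
  PowerSeries.mk fun n => iteratedDeriv n f 0 / (n ! : ℝ)

theorem taylorZero_congr {f g : ℝ → ℝ} (h : f =ᶠ[𝓝 0] g) : taylorZero f = taylorZero g := by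
  unfold taylorZero
  congr 1
  funext n
  rw [h.iteratedDeriv_eq n]

theorem taylorZero_deriv (f : ℝ → ℝ) :
    taylorZero (deriv f) = PowerSeries.derivative ℝ (taylorZero f) := by
  ext n
  rw [PowerSeries.coeff_derivative]
  simp only [taylorZero, PowerSeries.coeff_mk]
  rw [← iteratedDeriv_succ', Nat.factorial_succ]
  push_cast
  have : (n ! : ℝ) ≠ 0 := by exact_mod_cast n.factorial_ne_zero
  field_simp

theorem taylorZero_mul {f g : ℝ → ℝ} (hf : ∀ n : ℕ, ContDiffAt ℝ n f 0)
    (hg : ∀ n : ℕ, ContDiffAt ℝ n g 0) :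
    taylorZero (fun x => f x * g x) = taylorZero f * taylorZero g := by
  ext n
  rw [PowerSeries.coeff_mul]
  simp only [taylorZero, PowerSeries.coeff_mk]
  rw [iteratedDeriv_fun_mul (hf n) (hg n), Finset.Nat.sum_antidiagonal_eq_sum_range_succ_mk,
    Finset.sum_div]
  refine Finset.sum_congr rfl fun i hi => ?_
  have hin : i ≤ n := Nat.lt_succ_iff.1 (Finset.mem_range.1 hi)
  rw [Nat.cast_choose ℝ hin]
  have h1 : (n ! : ℝ) ≠ 0 := by exact_mod_cast n.factorial_ne_zero
  have h2 : (i ! : ℝ) ≠ 0 := by exact_mod_cast i.factorial_ne_zero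
  have h3 : ((n - i) ! : ℝ) ≠ 0 := by exact_mod_cast (n - i).factorial_ne_zero
  field_simp

theorem taylorZero_add {f g : ℝ → ℝ} (hf : ∀ n : ℕ, ContDiffAt ℝ n f 0)
    (hg : ∀ n : ℕ, ContDiffAt ℝ n g 0) :
    taylorZero (fun x => f x + g x) = taylorZero f + taylorZero g := by
  ext n
  simp only [taylorZero, PowerSeries.coeff_mk, map_add]
  rw [iteratedDeriv_fun_add (hf n) (hg n), add_div]

theorem taylorZero_const_mul (c : ℝ) (f : ℝ → ℝ) :
    taylorZero (fun x => c * f x) = PowerSeries.C c * taylorZero f := by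
  ext n
  simp only [taylorZero, PowerSeries.coeff_mk, PowerSeries.coeff_C_mul]
  rw [iteratedDeriv_const_mul_field]
  ring

theorem taylorZero_const (c : ℝ) : taylorZero (fun _ => c) = PowerSeries.C c := by
  ext n
  simp only [taylorZero, PowerSeries.coeff_mk, PowerSeries.coeff_C]
  rw [iteratedDeriv_const]
  split_ifs with h
  · simp [h]
  · simp

/-! ### Derivatives and Taylor coefficients of f and g at 0 -/

theorem cos_half_zero : Real.cos ((0 : ℝ) / 2) ≠ 0 := by simp

theorem eventually_cos_half_ne_zero : ∀ᶠ x : ℝ in 𝓝 0, Real.cos (x / 2) ≠ 0 :=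
  ContinuousAt.eventually_ne (g := fun x : ℝ => Real.cos (x / 2)) (by fun_prop) cos_half_zero

theorem contDiffAt_tan_half (n : ℕ) : ContDiffAt ℝ n (fun x : ℝ => Real.tan (x / 2)) 0 := by
  have h : ContDiffAt ℝ n Real.tan ((0 : ℝ) / 2) := Real.contDiffAt_tan.2 cos_half_zero
  exact h.comp (0 : ℝ) (f := fun x : ℝ => x / 2) (contDiffAt_id.div_const 2)

theorem hasDerivAt_tan_half {x : ℝ} (hx : Real.cos (x / 2) ≠ 0) :
    HasDerivAt (fun x : ℝ => Real.tan (x / 2)) (1 / (2 * Real.cos (x / 2) ^ 2)) x := by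
  have h := (Real.hasDerivAt_tan hx).comp x ((hasDerivAt_id x).div_const 2)
  refine h.congr_deriv ?_
  field_simp

theorem hasDerivAt_deriv_tan_half {x : ℝ} (hx : Real.cos (x / 2) ≠ 0) :
    HasDerivAt (fun x : ℝ => 1 / (2 * Real.cos (x / 2) ^ 2))
      (Real.sin (x / 2) / (2 * Real.cos (x / 2) ^ 3)) x := by
  have h := (((((hasDerivAt_id x).div_const 2).cos).fun_pow 2).const_mul 2).fun_inv
    (by simpa using hx)
  simp only [one_div]
  refine h.congr_deriv ?_
  simp only [id]
  field_simp
  ring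

theorem hasDerivAt_plusTan {q x : ℝ} (h0 : 0 < q) (h1 : q < 1) (hx : Real.cos (x / 2) ≠ 0) :
    HasDerivAt (plusTan q)
      (1 / (2 * Real.cos (x / 2) ^ 2) + 4 * cosSeries (plusLambert q 1) x) x := by
  have h := ((rapidDecay_plusLambert h0 h1 0).hasDerivAt_sinSeries x).const_mul 4
  rw [natCast_mul_plusLambert] at h
  exact (hasDerivAt_tan_half hx).add h

theorem hasDerivAt_minusTan {q x : ℝ} (h0 : 0 < q) (h1 : q < 1) (hx : Real.cos (x / 2) ≠ 0) :
    HasDerivAt (minusTan q)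
      (1 / (2 * Real.cos (x / 2) ^ 2) - 4 * cosSeries (minusLambert q 1) x) x := by
  have h := ((rapidDecay_minusLambert h0 h1 0).hasDerivAt_sinSeries x).const_mul 4
  rw [natCast_mul_minusLambert] at h
  exact (hasDerivAt_tan_half hx).sub h

theorem deriv_deriv_plusTan {q : ℝ} (h0 : 0 < q) (h1 : q < 1) :
    deriv (deriv (plusTan q)) =ᶠ[𝓝 0] fun x =>
      Real.sin (x / 2) / (2 * Real.cos (x / 2) ^ 3) - 4 * sinSeries (plusLambert q 2) x := by
  have h : deriv (plusTan q) =ᶠ[𝓝 0] fun x =>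
      1 / (2 * Real.cos (x / 2) ^ 2) + 4 * cosSeries (plusLambert q 1) x := by
    filter_upwards [eventually_cos_half_ne_zero] with x hx
    exact (hasDerivAt_plusTan h0 h1 hx).deriv
  refine h.deriv.trans ?_
  filter_upwards [eventually_cos_half_ne_zero] with x hx
  have h2 := ((rapidDecay_plusLambert h0 h1 1).hasDerivAt_cosSeries x).const_mul 4
  rw [natCast_mul_plusLambert] at h2
  rw [((hasDerivAt_deriv_tan_half hx).fun_add h2).deriv]
  ring

theorem contDiffAt_plusTan {q : ℝ} (h0 : 0 < q) (h1 : q < 1) (n : ℕ) :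
    ContDiffAt ℝ n (plusTan q) 0 :=
  (contDiffAt_tan_half n).add
    (contDiffAt_const.mul ((rapidDecay_plusLambert h0 h1 0).contDiff_sinSeries n).contDiffAt)

theorem contDiffAt_minusTan {q : ℝ} (h0 : 0 < q) (h1 : q < 1) (n : ℕ) :
    ContDiffAt ℝ n (minusTan q) 0 :=
  (contDiffAt_tan_half n).sub
    (contDiffAt_const.mul ((rapidDecay_minusLambert h0 h1 0).contDiff_sinSeries n).contDiffAt)

theorem iteratedDeriv_plusTan_zero {q : ℝ} (h0 : 0 < q) (h1 : q < 1) (n : ℕ) :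
    iteratedDeriv (2 * n + 1) (plusTan q) 0 =
      tangentNumber (n + 1) + 4 * (-1) ^ n * ∑' k, plusLambert q (2 * n + 1) k := by
  have hs := (rapidDecay_plusLambert h0 h1 0).contDiff_sinSeries (2 * n + 1)
  have h : iteratedDeriv (2 * n + 1) (plusTan q) 0 = _ :=
    iteratedDeriv_fun_add (contDiffAt_tan_half (2 * n + 1))
      (contDiffAt_const.mul hs.contDiffAt : ContDiffAt ℝ _
        (fun x => 4 * sinSeries (plusLambert q 0) x) 0)
  rw [h, iteratedDeriv_const_mul_field,
    (rapidDecay_plusLambert h0 h1 0).iteratedDeriv_sinSeries_zero, tangentNumber,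
    show 2 * (n + 1) - 1 = 2 * n + 1 by omega, ← mul_assoc]
  congr 3
  funext k
  unfold plusLambert
  ring

theorem iteratedDeriv_minusTan_zero {q : ℝ} (h0 : 0 < q) (h1 : q < 1) (n : ℕ) :
    iteratedDeriv (2 * n + 1) (minusTan q) 0 =
      tangentNumber (n + 1) - 4 * (-1) ^ n * ∑' k, minusLambert q (2 * n + 1) k := by
  have hs := (rapidDecay_minusLambert h0 h1 0).contDiff_sinSeries (2 * n + 1)
  have h : iteratedDeriv (2 * n + 1) (minusTan q) 0 = _ :=
    iteratedDeriv_fun_sub (contDiffAt_tan_half (2 * n + 1))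
      (contDiffAt_const.mul hs.contDiffAt : ContDiffAt ℝ _
        (fun x => 4 * sinSeries (minusLambert q 0) x) 0)
  rw [h, iteratedDeriv_const_mul_field,
    (rapidDecay_minusLambert h0 h1 0).iteratedDeriv_sinSeries_zero, tangentNumber,
    show 2 * (n + 1) - 1 = 2 * n + 1 by omega, ← mul_assoc]
  congr 3
  funext k
  unfold minusLambert
  ring

theorem tangentNumber_one : tangentNumber 1 = 1 / 2 := by
  rw [tangentNumber, show 2 * 1 - 1 = 1 by norm_num, iteratedDeriv_one,
    (hasDerivAt_tan_half cos_half_zero).deriv]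
  simp

theorem factorial_mul_coeff_taylorZero (f : ℝ → ℝ) (n : ℕ) :
    (n ! : ℝ) * PowerSeries.coeff n (taylorZero f) = iteratedDeriv n f 0 := by
  have : (n ! : ℝ) ≠ 0 := by exact_mod_cast n.factorial_ne_zero
  simp only [taylorZero, PowerSeries.coeff_mk]
  field_simp

theorem constantCoeff_taylorZero_plusTan (q : ℝ) :
    PowerSeries.constantCoeff (taylorZero (plusTan q)) = 0 := by
  rw [← PowerSeries.coeff_zero_eq_constantCoeff_apply]
  simp [taylorZero, plusTan_zero]

/-- Here Jacobi's four square theorem enters: it identifies 1/2 + 4 ∑ q^k k/(1+(-q)^k). -/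
theorem coeff_one_taylorZero_plusTan {q : ℝ} (h0 : 0 < q) (h1 : q < 1) :
    PowerSeries.coeff 1 (taylorZero (plusTan q)) = squareSeries q ^ 4 / 2 := by
  have h := factorial_mul_coeff_taylorZero (plusTan q) 1
  have h2 := iteratedDeriv_plusTan_zero h0 h1 0
  simp only [mul_zero, zero_add, pow_zero, mul_one, tangentNumber_one] at h2
  rw [h2, Nat.factorial_one, Nat.cast_one, one_mul] at h
  rw [h, squareSeries_pow_four h0 h1]
  simp only [plusLambert, pow_one]
  ring

/-- The trigonometric identities hold only where cos(x/2) ≠ 0, a neighbourhood of 0, which suffices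
to transfer them to formal power series. The coefficient 1/2 of f³ is written 2 · (1/4) to match β =
1/4. -/
theorem exists_taylorZero_identities {q : ℝ} (h0 : 0 < q) (h1 : q < 1) :
    ∃ κ T : ℝ,
      taylorZero (plusTan q) ^ 2 = PowerSeries.C κ +
        PowerSeries.C 2 * PowerSeries.derivative ℝ (taylorZero (minusTan q)) ∧
      PowerSeries.derivative ℝ (PowerSeries.derivative ℝ (taylorZero (plusTan q))) =
        PowerSeries.C T * taylorZero (plusTan q) +
          2 * PowerSeries.C (1 / 4) * taylorZero (plusTan q) ^ 3 := by
  obtain ⟨κ, T, H⟩ := exists_trig_identities h0 h1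
  have hp := contDiffAt_plusTan h0 h1
  have hp2 : ∀ n : ℕ, ContDiffAt ℝ n (fun x => plusTan q x * plusTan q x) 0 := fun n =>
    (hp n).mul (hp n)
  have hp3 : ∀ n : ℕ, ContDiffAt ℝ n (fun x => plusTan q x * plusTan q x * plusTan q x) 0 :=
    fun n => (hp2 n).mul (hp n)
  have hm : ∀ n : ℕ, ContDiffAt ℝ n (deriv (minusTan q)) 0 := fun n =>
    ContDiffAt.derivWithin (contDiffAt_minusTan h0 h1 (n + 1)) (by push_cast; exact le_rfl)
  refine ⟨κ, T, ?_, ?_⟩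
  · rw [sq, ← taylorZero_mul hp hp, ← taylorZero_deriv, ← taylorZero_const_mul,
      ← taylorZero_const, ← taylorZero_add (fun n => contDiffAt_const)
        (fun n => contDiffAt_const.mul (hm n))]
    apply taylorZero_congr
    filter_upwards [eventually_cos_half_ne_zero] with x hx
    rw [(hasDerivAt_minusTan h0 h1 hx).deriv, ← (H x hx).1, sq]
  · have h3 : (2 : PowerSeries ℝ) * PowerSeries.C (1 / 4 : ℝ) = PowerSeries.C (1 / 2) := by
      rw [← map_ofNat (PowerSeries.C (R := ℝ)) 2, ← map_mul]
      norm_num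
    rw [h3, pow_succ, sq, ← taylorZero_mul hp hp, ← taylorZero_mul hp2 hp, ← taylorZero_deriv,
      ← taylorZero_deriv, ← taylorZero_const_mul, ← taylorZero_const_mul,
      ← taylorZero_add (fun n => contDiffAt_const.mul (hp n))
        (fun n => contDiffAt_const.mul (hp3 n))]
    apply taylorZero_congr
    refine (deriv_deriv_plusTan h0 h1).trans ?_
    filter_upwards [eventually_cos_half_ne_zero] with x hx
    rw [(H x hx).2]
    ring

/-! ### Hankel determinants of solutions of `Y' ^ 2 = γ + α * Y ^ 2 + β * Y ^ 4` -/

open PowerSeries in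
/-- The second derivative of a power of a solution of `Y' ^ 2 = γ + α * Y ^ 2 + β * Y ^ 4`. -/
theorem derivative_derivative_pow {Y : ℝ⟦X⟧} {γ α β : ℝ}
    (h1 : (d⁄dX ℝ Y) ^ 2 = C γ + C α * Y ^ 2 + C β * Y ^ 4)
    (h2 : d⁄dX ℝ (d⁄dX ℝ Y) = C α * Y + 2 * C β * Y ^ 3) (n : ℕ) :
    d⁄dX ℝ (d⁄dX ℝ (Y ^ (n + 2))) =
      C ((n + 2) * (n + 1) * γ) * Y ^ n + C ((n + 2) ^ 2 * α) * Y ^ (n + 2) +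
        C ((n + 2) * (n + 3) * β) * Y ^ (n + 4) := by
  have e : ∀ k : ℕ, ((k : ℕ) : ℝ⟦X⟧) = C (k : ℝ) := fun k => by simp
  rw [derivative_pow, Derivation.leibniz, Derivation.leibniz, derivative_pow, h2]
  simp only [smul_eq_mul, Derivation.map_natCast, map_mul, map_add, map_pow, map_natCast,
    map_ofNat, map_one, show n + 2 - 1 = n + 1 by omega, show n + 1 - 1 = n by omega]
  push_cast
  have h3 : (n + 2 : ℝ⟦X⟧) * (n + 1) * Y ^ n * (d⁄dX ℝ Y) ^ 2 =
      (n + 2 : ℝ⟦X⟧) * (n + 1) * Y ^ n * (C γ + C α * Y ^ 2 + C β * Y ^ 4) := by rw [h1]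
  linear_combination h3

open PowerSeries in
/-- A second order equation integrates to a first order equation. -/
theorem derivative_sq_of_derivative_derivative {Y : ℝ⟦X⟧} {α β : ℝ}
    (h0 : constantCoeff Y = 0)
    (h2 : d⁄dX ℝ (d⁄dX ℝ Y) = C α * Y + 2 * C β * Y ^ 3) :
    (d⁄dX ℝ Y) ^ 2 = C (coeff 1 Y ^ 2) + C α * Y ^ 2 + C β * Y ^ 4 := by
  apply derivative.ext
  · simp only [map_add, Derivation.leibniz, derivative_pow, derivative_C, h2, smul_eq_mul]
    push_cast
    ring
  · have h : constantCoeff (d⁄dX ℝ Y) = coeff 1 Y := by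
      rw [← coeff_zero_eq_constantCoeff_apply, coeff_derivative]
      simp
    simp [h, h0]

open PowerSeries in
-- Each double differentiation raises the top exponent k of Y to k + 2 with factor k(k+1)β; these
-- factors accumulate to (2i+e-1)! β^i. The coefficients a do not depend on the truncation N.
theorem exists_iterate_derivative_eq {Y : ℝ⟦X⟧} {γ α β : ℝ} {e : ℕ} (he : e = 1 ∨ e = 2)
    (h1 : (d⁄dX ℝ Y) ^ 2 = C γ + C α * Y ^ 2 + C β * Y ^ 4)
    (h2 : d⁄dX ℝ (d⁄dX ℝ Y) = C α * Y + 2 * C β * Y ^ 3) (i : ℕ) :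
    ∃ (a : ℕ → ℝ) (κ : ℝ), (∀ r, i < r → a r = 0) ∧ a i = (2 * i + e - 1)! * β ^ i ∧
      ∀ N, i < N → (d⁄dX ℝ)^[2 * i] (Y ^ e) =
        C κ + ∑ r ∈ Finset.range N, C (a r) * Y ^ (2 * r + e) := by
  induction i with
  | zero =>
    refine ⟨fun r => if r = 0 then 1 else 0, 0, fun r hr => by simp [hr.ne'], ?_, fun N hN => ?_⟩
    · rcases he with rfl | rfl <;> simp
    · rw [Finset.sum_eq_single 0]
      · simp
      · intro r _ hr
        simp [hr]
      · intro h
        exact absurd (Finset.mem_range.2 hN) h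
  | succ i ih =>
    obtain ⟨a, κ, ha0, hai, ha⟩ := ih
    -- the action of the second derivative on the powers of `Y`
    have hstep : ∃ (κ' : ℝ) (A B D : ℕ → ℝ), (∀ r : ℕ, D r = (2 * r + e) * (2 * r + e + 1) * β) ∧
        ∀ r : ℕ, d⁄dX ℝ (d⁄dX ℝ (Y ^ (2 * r + e))) =
          (if r = 0 then C κ' else C (A r) * Y ^ (2 * (r - 1) + e)) +
          C (B r) * Y ^ (2 * r + e) + C (D r) * Y ^ (2 * (r + 1) + e) := by
      rcases he with rfl | rfl
      · refine ⟨0, fun r => (2 * r + 1) * (2 * r) * γ, fun r => (2 * r + 1) ^ 2 * α,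
          fun r => (2 * r + 1) * (2 * r + 2) * β, fun r => by push_cast; ring, fun r => ?_⟩
        rcases r with _ | r
        · simp [h2]
          exact Or.inl (Or.inl (map_ofNat C 2).symm)
        · rw [show 2 * (r + 1) + 1 = 2 * r + 1 + 2 by ring, derivative_derivative_pow h1 h2]
          rw [if_neg (by omega), show 2 * (r + 1 - 1) + 1 = 2 * r + 1 by omega,
            show 2 * (r + 1 + 1) + 1 = 2 * r + 1 + 4 by ring]
          push_cast
          ring_nf
      · refine ⟨2 * γ, fun r => (2 * r + 2) * (2 * r + 1) * γ, fun r => (2 * r + 2) ^ 2 * α,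
          fun r => (2 * r + 2) * (2 * r + 3) * β, fun r => by push_cast; ring, fun r => ?_⟩
        rcases r with _ | r
        · have := derivative_derivative_pow h1 h2 0
          norm_num at this ⊢
          rw [this]
        · rw [show 2 * (r + 1) + 2 = 2 * r + 2 + 2 by ring, derivative_derivative_pow h1 h2]
          rw [if_neg (by omega), show 2 * (r + 1 - 1) + 2 = 2 * r + 2 by omega,
            show 2 * (r + 1 + 1) + 2 = 2 * r + 2 + 4 by ring]
          push_cast
          ring_nf
    obtain ⟨κ', A, B, D, hD, hstep⟩ := hstep
    -- The exponent 2r+e receives terms from r+1, r and r-1. The lowest power Y^e produces a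
    -- constant in place of a lower power: 0 for e = 1, and 2γ for e = 2.
    refine ⟨fun r => a (r + 1) * A (r + 1) + a r * B r + (if r = 0 then 0 else a (r - 1) * D (r - 1)),
      a 0 * κ', fun r hr => ?_, ?_, fun N hN => ?_⟩
    · simp only
      rw [ha0 _ (by omega), ha0 r (by omega), if_neg (by omega), ha0 (r - 1) (by omega)]
      ring
    · simp only
      rw [ha0 _ (by omega), ha0 (i + 1) (by omega), if_neg (by omega), Nat.add_sub_cancel, hai, hD]
      have hf : (2 * (i + 1) + e - 1)! = (2 * i + e + 1) * ((2 * i + e) * (2 * i + e - 1)!) := by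
        rw [Nat.mul_factorial_pred (by omega), ← Nat.factorial_succ]
        congr 1
        omega
      rw [hf]
      push_cast
      ring
    · obtain ⟨N, rfl⟩ : ∃ M, N = M + 1 := ⟨N - 1, by omega⟩
      rw [show 2 * (i + 1) = 2 * i + 1 + 1 by ring, Function.iterate_succ_apply',
        Function.iterate_succ_apply', ha N (by omega)]
      simp only [map_add, map_sum, Derivation.leibniz, derivative_C, smul_eq_mul, mul_zero,
        add_zero, zero_add, hstep]
      have hA : ∑ r ∈ Finset.range N, C (a r) *
          (if r = 0 then C κ' else C (A r) * Y ^ (2 * (r - 1) + e)) =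
          C (a 0 * κ') + ∑ r ∈ Finset.range (N + 1),
            C (a (r + 1) * A (r + 1)) * Y ^ (2 * r + e) := by
        obtain ⟨M, rfl⟩ : ∃ M, N = M + 1 := ⟨N - 1, by omega⟩
        rw [Finset.sum_range_succ', Finset.sum_range_succ _ (M + 1), Finset.sum_range_succ _ M,
          ha0 (M + 1) (by omega), ha0 (M + 1 + 1) (by omega), add_comm]
        simp [mul_assoc]
      have hB : ∑ r ∈ Finset.range N, C (a r) * (C (B r) * Y ^ (2 * r + e)) =
          ∑ r ∈ Finset.range (N + 1), C (a r * B r) * Y ^ (2 * r + e) := by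
        rw [Finset.sum_range_succ, ha0 N (by omega)]
        simp [mul_assoc]
      have hC : ∑ r ∈ Finset.range N, C (a r) * (C (D r) * Y ^ (2 * (r + 1) + e)) =
          ∑ r ∈ Finset.range (N + 1),
            C (if r = 0 then 0 else a (r - 1) * D (r - 1)) * Y ^ (2 * r + e) := by
        rw [Finset.sum_range_succ']
        simp [mul_assoc]
      simp only [mul_add, Finset.sum_add_distrib, add_mul] at hA hB hC ⊢
      rw [hA, hB, hC]
      ring

open PowerSeries in
theorem coeff_pow_of_constantCoeff_eq_zero {Y : ℝ⟦X⟧} (h0 : constantCoeff Y = 0) {k n : ℕ}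
    (hkn : k ≤ n) : coeff k (Y ^ n) = if k = n then coeff 1 Y ^ n else 0 := by
  obtain ⟨U, rfl⟩ := X_dvd_iff.2 h0
  rw [mul_pow, coeff_X_pow_mul']
  split_ifs with h1 h2 h2
  · subst h2
    have : coeff 1 (X * U) = constantCoeff U := by
      rw [← coeff_zero_eq_constantCoeff_apply, ← coeff_succ_X_mul 0 U]
    rw [this, Nat.sub_self, coeff_zero_eq_constantCoeff_apply, map_pow]
  · omega
  · omega
  · rfl

open PowerSeries in
/-- The Hankel determinant of the Taylor coefficients of `Y ^ e`, `e = 1, 2`. -/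
theorem det_hankel_pow {Y : ℝ⟦X⟧} {α β : ℝ} {e : ℕ} (he : e = 1 ∨ e = 2)
    (h0 : constantCoeff Y = 0)
    (h2 : d⁄dX ℝ (d⁄dX ℝ Y) = C α * Y + 2 * C β * Y ^ 3) (m : ℕ) :
    Matrix.det (Matrix.of fun i j : Fin m =>
      ((2 * (i + j : ℕ) + e)! : ℝ) * coeff (2 * (i + j : ℕ) + e) (Y ^ e)) =
      ∏ i ∈ Finset.range m,
        (((2 * i + e - 1)! : ℝ) * β ^ i * ((2 * i + e)! * coeff 1 Y ^ (2 * i + e))) := by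
  have h1 := derivative_sq_of_derivative_derivative h0 h2
  choose a κ ha0 hai ha using exists_iterate_derivative_eq he h1 h2
  -- The derivative of order 2(i+j)+e at 0 is the derivative of order 2j+e of the 2i-th derivative;
  -- the constant κ i drops out because 2j+e > 0.
  have hcoef : ∀ i j : ℕ, i < m → ((2 * (i + j) + e)! : ℝ) * coeff (2 * (i + j) + e) (Y ^ e) =
      ∑ r ∈ Finset.range m, a i r * ((2 * j + e)! * coeff (2 * j + e) (Y ^ (2 * r + e))) := by
    intro i j hi
    have h := congrArg (fun F => ((2 * j + e)! : ℝ) * coeff (2 * j + e) F) (ha i m hi)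
    simp only [coeff_iterate_derivative, map_add, map_sum, coeff_C_mul] at h
    have hasc : (2 * j + e)! * (2 * j + e + 1).ascFactorial (2 * i) = (2 * (i + j) + e)! := by
      rw [Nat.factorial_mul_ascFactorial]
      congr 1
      ring
    rw [← mul_assoc, ← Nat.cast_mul, hasc, show 2 * j + e + 2 * i = 2 * (i + j) + e by ring,
      coeff_C, if_neg (by omega), zero_add, Finset.mul_sum] at h
    rw [h]
    exact Finset.sum_congr rfl fun r _ => by ring
  have hmat : (Matrix.of fun i j : Fin m =>
      ((2 * (i + j : ℕ) + e)! : ℝ) * coeff (2 * (i + j : ℕ) + e) (Y ^ e)) =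
      (Matrix.of fun i r : Fin m => a i r) * (Matrix.of fun r j : Fin m =>
        ((2 * (j : ℕ) + e)! : ℝ) * coeff (2 * (j : ℕ) + e) (Y ^ (2 * (r : ℕ) + e))) := by
    ext i j
    rw [Matrix.mul_apply]
    simp only [Matrix.of_apply]
    rw [hcoef i j i.2, Finset.sum_range]
  rw [hmat, Matrix.det_mul, Matrix.det_of_isLowerTriangular, Matrix.det_of_isUpperTriangular,
    ← Finset.prod_mul_distrib, Finset.prod_range]
  · refine Finset.prod_congr rfl fun i _ => ?_
    simp only [Matrix.of_apply]
    rw [hai, coeff_pow_of_constantCoeff_eq_zero h0 le_rfl, if_pos rfl]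
  · intro r j hrj
    have hlt : (j : ℕ) < r := hrj
    simp only [Matrix.of_apply]
    rw [coeff_pow_of_constantCoeff_eq_zero h0 (by omega), if_neg (by omega), mul_zero]
  · intro i r hir
    have hlt : (i : ℕ) < r := hir
    exact ha0 i r hlt

/-! ### Factorials and powers of two in the normalizing constants -/

theorem prod_range_factorial_eq (n : ℕ) :
    ∏ i ∈ Finset.range (n + 1), (i ! : ℝ) = ∏ i ∈ Finset.Icc 1 n, (i ! : ℝ) := by
  induction n with
  | zero => simp
  | succ n ih => rw [Finset.prod_range_succ, ih, Finset.prod_Icc_succ_top (by omega)]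

theorem prod_range_factorial_mul_odd (m : ℕ) :
    ∏ i ∈ Finset.range m, (((2 * i)! : ℝ) * (2 * i + 1)!) =
      ∏ i ∈ Finset.Icc 1 (2 * m - 1), (i ! : ℝ) := by
  have h : ∏ i ∈ Finset.range m, (((2 * i)! : ℝ) * (2 * i + 1)!) =
      ∏ i ∈ Finset.range (2 * m), (i ! : ℝ) := by
    induction m with
    | zero => simp
    | succ m ih =>
      rw [Finset.prod_range_succ, ih, show 2 * (m + 1) = 2 * m + 1 + 1 by ring,
        Finset.prod_range_succ, Finset.prod_range_succ, mul_assoc]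
  rw [h]
  -- For m = 0 the truncated subtraction gives 2m - 1 = 0, and both products are empty.
  rcases m with _ | m
  · simp
  · rw [show 2 * (m + 1) = 2 * m + 1 + 1 by ring, prod_range_factorial_eq]
    rfl

theorem prod_range_factorial_mul_even (m : ℕ) :
    ∏ i ∈ Finset.range m, (((2 * i + 1)! : ℝ) * (2 * i + 2)!) =
      ∏ i ∈ Finset.Icc 1 (2 * m), (i ! : ℝ) := by
  rw [← prod_range_factorial_eq]
  induction m with
  | zero => simp
  | succ m ih =>
    rw [Finset.prod_range_succ, ih, show 2 * (m + 1) + 1 = 2 * m + 1 + 1 + 1 by ring,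
      Finset.prod_range_succ _ (2 * m + 1 + 1), Finset.prod_range_succ _ (2 * m + 1), mul_assoc]

theorem two_pow_mul_prod_odd (c : ℝ) (m : ℕ) :
    2 ^ (m * (2 * m - 1)) * ∏ i ∈ Finset.range m, ((1 / 4 : ℝ) ^ i * c ^ (2 * i + 1)) =
      (2 * c) ^ (m ^ 2) := by
  induction m with
  | zero => simp
  | succ m ih =>
    have h1 : (m + 1) * (2 * (m + 1) - 1) = m * (2 * m - 1) + (4 * m + 1) := by
      rcases m with _ | k
      · rfl
      · rw [show 2 * (k + 1 + 1) - 1 = 2 * k + 3 by omega, show 2 * (k + 1) - 1 = 2 * k + 1 by omega]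
        ring
    have h2 : (2 : ℝ) ^ (4 * m + 1) * ((1 / 4) ^ m * c ^ (2 * m + 1)) = (2 * c) ^ (2 * m + 1) := by
      have h3 : (2 : ℝ) ^ (4 * m + 1) * (1 / 4) ^ m = 2 ^ (2 * m + 1) := by
        rw [show 4 * m + 1 = 2 * m + 1 + 2 * m by ring, pow_add, mul_assoc, pow_mul 2 2 m,
          ← mul_pow]
        norm_num
      rw [← mul_assoc, h3, mul_pow]
    rw [Finset.prod_range_succ, h1, pow_add (2 : ℝ) _ (4 * m + 1), show (m + 1) ^ 2 = m ^ 2 + (2 * m + 1) by ring,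
      pow_add (2 * c), ← ih, ← h2]
    ring

theorem two_pow_mul_prod_even (c : ℝ) (m : ℕ) :
    2 ^ (m * (2 * m + 1)) *
      ((1 / 2) ^ m * ∏ i ∈ Finset.range m, ((1 / 4 : ℝ) ^ i * c ^ (2 * i + 2))) =
      (2 * c) ^ (m * (m + 1)) := by
  induction m with
  | zero => simp
  | succ m ih =>
    have h2 : (2 : ℝ) ^ (4 * m + 3) * (1 / 2 * ((1 / 4) ^ m * c ^ (2 * m + 2))) =
        (2 * c) ^ (2 * m + 2) := by
      have h3 : (2 : ℝ) ^ (4 * m + 3) * (1 / 2 * (1 / 4) ^ m) = 2 ^ (2 * m + 2) := by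
        rw [show 4 * m + 3 = (2 * m + 2) + 1 + 2 * m by ring, pow_add, pow_succ, pow_mul 2 2 m,
          show (2 : ℝ) ^ (2 * m + 2) * 2 * (2 ^ 2) ^ m * (1 / 2 * (1 / 4) ^ m) =
            2 ^ (2 * m + 2) * ((2 ^ 2) ^ m * (1 / 4) ^ m) by ring, ← mul_pow]
        norm_num
      rw [← mul_assoc (1 / 2 : ℝ), ← mul_assoc, h3, mul_pow]
    rw [Finset.prod_range_succ,
      show (m + 1) * (2 * (m + 1) + 1) = m * (2 * m + 1) + (4 * m + 3) by ring,
      pow_add (2 : ℝ) _ (4 * m + 3),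
      show (m + 1) * (m + 1 + 1) = m * (m + 1) + (2 * m + 2) by ring, pow_add (2 * c), ← ih, ← h2]
    ring

theorem prod_Icc_factorial_ne_zero (n : ℕ) : ∏ i ∈ Finset.Icc 1 n, (i ! : ℝ) ≠ 0 :=
  Finset.prod_ne_zero_iff.2 fun i _ => by exact_mod_cast i.factorial_ne_zero

/-! ### The two determinant formulas -/

open PowerSeries in
/-- The Hankel determinant of the derivatives of `plusTan q` at `0`. -/
theorem plusTan_hankel {q : ℝ} (h0 : 0 < q) (h1 : q < 1) (m : ℕ) :
    squareSeries q ^ (4 * m ^ 2) =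
      2 ^ (m * (2 * m - 1)) / (∏ i ∈ Finset.Icc 1 (2 * m - 1), (i ! : ℝ)) *
        Matrix.det (Matrix.of fun i j : Fin m =>
          iteratedDeriv (2 * (i + j : ℕ) + 1) (plusTan q) 0) := by
  obtain ⟨κ, T, -, hode⟩ := exists_taylorZero_identities h0 h1
  have hdet := det_hankel_pow (e := 1) (Or.inl rfl) (constantCoeff_taylorZero_plusTan q) hode m
  simp only [pow_one, factorial_mul_coeff_taylorZero] at hdet
  rw [hdet, coeff_one_taylorZero_plusTan h0 h1]
  simp only [Nat.add_sub_cancel]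
  have h4 : ∏ i ∈ Finset.range m, (((2 * i)! : ℝ) * (1 / 4) ^ i *
      ((2 * i + 1)! * (squareSeries q ^ 4 / 2) ^ (2 * i + 1))) =
      (∏ i ∈ Finset.Icc 1 (2 * m - 1), (i ! : ℝ)) *
        ∏ i ∈ Finset.range m, ((1 / 4) ^ i * (squareSeries q ^ 4 / 2) ^ (2 * i + 1)) := by
    rw [← prod_range_factorial_mul_odd, ← Finset.prod_mul_distrib]
    exact Finset.prod_congr rfl fun i _ => by ring
  rw [h4, div_mul_eq_mul_div, mul_left_comm, mul_div_cancel_left₀ _ (prod_Icc_factorial_ne_zero _),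
    two_pow_mul_prod_odd, mul_div_cancel₀ _ two_ne_zero, ← pow_mul]

open PowerSeries in
/-- The Hankel determinant of the derivatives of `minusTan q` at `0`, starting from the third. -/
theorem minusTan_hankel {q : ℝ} (h0 : 0 < q) (h1 : q < 1) (m : ℕ) :
    squareSeries q ^ (4 * m * (m + 1)) =
      2 ^ (m * (2 * m + 1)) / (∏ i ∈ Finset.Icc 1 (2 * m), (i ! : ℝ)) *
        Matrix.det (Matrix.of fun i j : Fin m =>
          iteratedDeriv (2 * (i + j + 1 : ℕ) + 1) (minusTan q) 0) := by
  obtain ⟨κ, T, hsq, hode⟩ := exists_taylorZero_identities h0 h1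
  have hdet := det_hankel_pow (e := 2) (Or.inr rfl) (constantCoeff_taylorZero_plusTan q) hode m
  -- From g' = (f² - κ)/2: the derivative of g of order 2(i+j)+3 is half that of f² of order
  -- 2(i+j)+2, where κ no longer contributes.
  have hentry : (Matrix.of fun i j : Fin m =>
      iteratedDeriv (2 * (i + j + 1 : ℕ) + 1) (minusTan q) 0) =
      (1 / 2 : ℝ) • (Matrix.of fun i j : Fin m =>
      ((2 * (i + j : ℕ) + 2)! : ℝ) * coeff (2 * (i + j : ℕ) + 2) (taylorZero (plusTan q) ^ 2)) := by
    ext i j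
    simp only [Matrix.of_apply, Matrix.smul_apply, smul_eq_mul]
    rw [← factorial_mul_coeff_taylorZero, hsq, map_add, coeff_C, if_neg (by omega), coeff_C_mul,
      coeff_derivative, show 2 * ((i : ℕ) + j + 1) + 1 = 2 * ((i : ℕ) + j) + 2 + 1 by ring,
      Nat.factorial_succ]
    push_cast
    ring
  rw [hentry, Matrix.det_smul, Fintype.card_fin, hdet, coeff_one_taylorZero_plusTan h0 h1]
  have h4 : ∏ i ∈ Finset.range m, (((2 * i + 2 - 1)! : ℝ) * (1 / 4) ^ i *
      ((2 * i + 2)! * (squareSeries q ^ 4 / 2) ^ (2 * i + 2))) =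
      (∏ i ∈ Finset.Icc 1 (2 * m), (i ! : ℝ)) *
        ∏ i ∈ Finset.range m, ((1 / 4) ^ i * (squareSeries q ^ 4 / 2) ^ (2 * i + 2)) := by
    rw [← prod_range_factorial_mul_even, ← Finset.prod_mul_distrib]
    refine Finset.prod_congr rfl fun i _ => ?_
    rw [show 2 * i + 2 - 1 = 2 * i + 1 by omega]
    ring
  rw [h4, div_mul_eq_mul_div, mul_left_comm ((1 / 2 : ℝ) ^ m), mul_left_comm,
    mul_div_cancel_left₀ _ (prod_Icc_factorial_ne_zero _), two_pow_mul_prod_even,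
    mul_div_cancel₀ _ two_ne_zero, ← pow_mul, mul_assoc]

/-- Matrix indices run over `Fin m`, that is, the index `i` here is the usual index minus one. -/
theorem corollary3p6 (q : ℝ) (hq0 : 0 < q) (hq1 : q < 1) (m : ℕ) :
    squareSeries q ^ (4 * m ^ 2) =
      2 ^ (m * (2 * m - 1)) / (∏ i ∈ Finset.Icc 1 (2 * m - 1), (i ! : ℝ)) *
        Matrix.det (Matrix.of fun i j : Fin m =>
          tangentNumber ((i : ℕ) + j + 1) +
            4 * (-1) ^ ((i : ℕ) + j) *
              ∑' k : ℕ+, q ^ (k : ℕ) * (k : ℝ) ^ (2 * (i : ℕ) + 2 * j + 1) /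
                (1 + (-q) ^ (k : ℕ))) ∧
    squareSeries q ^ (4 * m * (m + 1)) =
      2 ^ (m * (2 * m + 1)) / (∏ i ∈ Finset.Icc 1 (2 * m), (i ! : ℝ)) *
        Matrix.det (Matrix.of fun i j : Fin m =>
          tangentNumber ((i : ℕ) + j + 2) +
            4 * (-1) ^ ((i : ℕ) + j) *
              ∑' k : ℕ+, q ^ (k : ℕ) * (k : ℝ) ^ (2 * (i : ℕ) + 2 * j + 3) /
                (1 - (-q) ^ (k : ℕ))) := by
  constructor
  · rw [plusTan_hankel hq0 hq1]
    congr 3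
    funext i j
    rw [iteratedDeriv_plusTan_zero hq0 hq1, mul_add]
    rfl
  · rw [minusTan_hankel hq0 hq1]
    congr 3
    funext i j
    -- The index is i+j+1 here, and the extra factor -1 turns the minus sign in g into the plus sign
    -- of the statement.
    rw [iteratedDeriv_minusTan_zero hq0 hq1, pow_succ]
    simp only [minusLambert]
    rw [show 2 * ((i : ℕ) + j + 1) + 1 = 2 * (i : ℕ) + 2 * j + 3 by ring]
    ring
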